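/- Let $c>0$ and $d\ge 0$. The enhanced helix-3-graph has vertex set $\mathbb Z$ and edges $z_m=\{m-1,m\}$, $g_m=\{m-2,m\}$, $h_m=\{m-3,m\}$, $m\in\mathbb Z$, with weights $c$ on the $z_m$, $d$ on the $g_m$ and $1$ on the $h_m$. For $n\in\mathbb N$ let $\mathbf P_n$ be the weighted spanning tree measure of the finite subgraph induced on $\{-n,\dots,n\}$, that is, a spanning tree has probability proportional to the product of the weights of its edges. Then: (a) The weak limit $\mathbf P=\lim_{n\to\infty}\mathbf P_n$ (convergence of the probabilities of all events depending on finitely many edges) exists and is a unique probability measure on sets of edges. Let $T$ be the random edge set with law $\mathbf P$. (b) Let $$f(x)=\frac{c}{(c+2d+3)+2(d+2)\cos(2\pi x)+2\cos(4\pi x)} .$$ Then $f$ is measurable with $0<f\le 1$. With $\hat f(k)=\int_0^1 f(x)e^{-2\pi i kx}\,dx$, the rung process $X_m=\mathbf 1_{\{z_m\in T\}}$, $m\in\mathbb Z$, is a Hermitian determinantal point process with the real symmetric Toeplitz matrix $A_{k,l}=\hat f(l-k)$, that is, $\mathbf P[X_s=1\text{ for all }s\in S]=\det\big((A_{k,l})_{k,l\in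 S}\big)$ for all finite $S\subset\mathbb Z$. (c) Let $$g(x)=c^{-1}\big[x^4+(d+2)x^3+(c+2d+3)x^2+(d+2)x+1\big]$$ and, with principal branches of the complex square root, $$x_{1}=\tfrac14\big(-d-2+\sqrt{d^2-4d-4c}\big)+\tfrac14\sqrt{\big(-d-2+\sqrt{d^2-4d-4c}\big)^2-16},$$ $$x_{2}=\tfrac14\big(-d-2-\sqrt{d^2-4d-4c}\big)+\tfrac14\sqrt{\big(-d-2-\sqrt{d^2-4d-4c}\big)^2-16}.$$ Then, counted with multiplicity, $x_1,x_2$ are exactly the roots of $g$ in $\{z\in\mathbb C:|z|<1\}$. If $d^2-4d-4c\neq 0$, then $x_1\ne x_2$ and $$\hat f(m)=\frac{x_1}{g'(x_1)}\,x_1^{|m|}+\frac{x_2}{g'(x_2)}\,x_2^{|m|}\qquad\text{for all } m\in\mathbb Z .$$ -/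

import Mathlib

open MeasureTheory Filter Topology

noncomputable section

namespace EnhancedHelix

/-! ### Determinantal processes and Fourier coefficients -/

open Classical in
/-- A `{0,1}`-valued process `X` indexed by `R` on the probability space `(Ω, P)` is a (Hermitian)
determinantal point process with matrix `A` if `A` is Hermitian and, for every finite `S ⊆ R`,
`P[X s = 1 for all s ∈ S] = det (A i j)_{i, j ∈ S}`. -/
structure IsDeterminantal {Ω R : Type*} [MeasurableSpace Ω] (P : Measure Ω)
    (X : R → Ω → Fin 2) (A : Matrix R R ℂ) : Prop where
  isProbabilityMeasure : IsProbabilityMeasure P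
  measurable : ∀ s, Measurable (X s)
  isHermitian : A.IsHermitian
  prob_eq_det : ∀ S : Finset R,
    ((P.real {ω | ∀ s ∈ S, X s ω = 1} : ℝ) : ℂ)
      = (A.submatrix (fun i : S => (i : R)) (fun j : S => (j : R))).det

/-- The Fourier coefficient `∫_{[0,1]} f(x) e^{-2πi k x} dx`. -/
def fourierHat (f : ℝ → ℝ) (k : ℤ) : ℂ :=
  ∫ x in Set.Icc (0 : ℝ) 1, (f x : ℂ) * Complex.exp (-2 * Real.pi * Complex.I * k * x)

/-! ### The enhanced helix-3-graph -/

/-- The edge `z_m = {m - 1, m}` (a rung). -/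
def zEdge (m : ℤ) : Sym2 ℤ := s(m - 1, m)

/-- The edge `g_m = {m - 2, m}`. -/
def gEdge (m : ℤ) : Sym2 ℤ := s(m - 2, m)

/-- The edge `h_m = {m - 3, m}`. -/
def hEdge (m : ℤ) : Sym2 ℤ := s(m - 3, m)

/-- The edge set of the enhanced helix-3-graph; its vertex set is `ℤ`. -/
def edges : Set (Sym2 ℤ) := Set.range zEdge ∪ Set.range gEdge ∪ Set.range hEdge

open Classical in
/-- The edge weights: `c` on the `z_m`, `d` on the `g_m` and `1` on the `h_m`. -/
def edgeWeight (c d : ℝ) (e : Sym2 ℤ) : ℝ :=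
  if e ∈ Set.range zEdge then c
  else if e ∈ Set.range gEdge then d
  else if e ∈ Set.range hEdge then 1
  else 0

open Classical in
/-- The edges of the subgraph induced on `{m, …, n}`. -/
def finiteEdges (m n : ℤ) : Finset (Sym2 ℤ) := {e ∈ (Finset.Icc m n).sym2 | e ∈ edges}

open Classical in
/-- The spanning trees of the subgraph induced on `{m, …, n}`, as sets of edges. -/
def spanningTrees (m n : ℤ) : Finset (Finset (Sym2 ℤ)) :=
  {t ∈ (finiteEdges m n).powerset |
    ((SimpleGraph.fromEdgeSet (t : Set (Sym2 ℤ))).induce (Set.Icc m n)).IsTree}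

/-- The weight of a set of edges. -/
def treeWeight (c d : ℝ) (t : Finset (Sym2 ℤ)) : ℝ := ∏ e ∈ t, edgeWeight c d e

open Classical in
/-- The probability of the event `F` under the weighted spanning tree measure of the subgraph
induced on `{-n, …, n}`. -/
def finiteProb (c d : ℝ) (n : ℕ) (F : Set (Set (Sym2 ℤ))) : ℝ :=
  (∑ t ∈ (spanningTrees (-n) n).filter (fun t : Finset (Sym2 ℤ) => (t : Set (Sym2 ℤ)) ∈ F),
      treeWeight c d t)
    / ∑ t ∈ spanningTrees (-n) n, treeWeight c d t

/-- The event that the random edge set agrees with `B` on the finite window `K`. -/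
def windowEvent (K : Finset (Sym2 ℤ)) (B : Set (Sym2 ℤ)) : Set (Set (Sym2 ℤ)) :=
  {T | ∀ e ∈ K, e ∈ T ↔ e ∈ B}

/-- `P` is the law of the weighted random spanning tree on the (infinite) enhanced helix-3-graph:
the weak limit, i.e. the limit on all cylinder events, of the weighted spanning tree measures of
the finite subgraphs induced on `{-n, …, n}`. -/
structure IsSpanningTreeMeasure (c d : ℝ) (P : Measure (Set (Sym2 ℤ))) : Prop where
  isProbabilityMeasure : IsProbabilityMeasure P
  tendsto : ∀ (K : Finset (Sym2 ℤ)) (B : Set (Sym2 ℤ)),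
    Tendsto (fun n : ℕ => finiteProb c d n (windowEvent K B)) atTop (𝓝 (P.real (windowEvent K B)))

open Classical in
/-- The rung process `X_m = 1_T(z_m)`. -/
def rungProcess (m : ℤ) (T : Set (Sym2 ℤ)) : Fin 2 := if zEdge m ∈ T then 1 else 0

/-! ### The explicit kernel -/

/-- `f(x) = c / ((c + 2d + 3) + 2 (d + 2) cos 2πx + 2 cos 4πx)`. -/
def symbol (c d x : ℝ) : ℝ :=
  c / ((c + 2 * d + 3) + 2 * (d + 2) * Real.cos (2 * Real.pi * x) + 2 * Real.cos (4 * Real.pi * x))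

open Polynomial in
/-- `g(x) = c⁻¹ (x⁴ + (d + 2) x³ + (c + 2d + 3) x² + (d + 2) x + 1)`. -/
def quartic (c d : ℝ) : ℂ[X] :=
  C ((c : ℂ)⁻¹) * (X ^ 4 + C ((d : ℂ) + 2) * X ^ 3 + C ((c : ℂ) + 2 * d + 3) * X ^ 2
    + C ((d : ℂ) + 2) * X + 1)

/-- The principal branch of the complex square root. -/
def csqrt (z : ℂ) : ℂ := z ^ (1 / 2 : ℂ)

/-- The root `x₁`. -/
def root₁ (c d : ℝ) : ℂ :=
  1 / 4 * (-d - 2 + csqrt (d ^ 2 - 4 * d - 4 * c))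
    + 1 / 4 * csqrt ((-d - 2 + csqrt (d ^ 2 - 4 * d - 4 * c)) ^ 2 - 16)

/-- The root `x₂`. -/
def root₂ (c d : ℝ) : ℂ :=
  1 / 4 * (-d - 2 - csqrt (d ^ 2 - 4 * d - 4 * c))
    + 1 / 4 * csqrt ((-d - 2 - csqrt (d ^ 2 - 4 * d - 4 * c)) ^ 2 - 16)

/-- The Toeplitz matrix `A_{k,l} = f̂(l - k)` of the symbol `f`. -/
def kernel (c d : ℝ) : Matrix ℤ ℤ ℂ := Matrix.of fun k l => fourierHat (symbol c d) (l - k)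

end EnhancedHelix

end

open MeasureTheory Filter Topology

noncomputable section

namespace EnhancedHelix

/-! Potential differences along the path of rungs are used as coordinates. An edge $\{a,b\}$ with
$a<b$ becomes the indicator of $(a,b]$, so that $g_m$ and $h_m$ cover two and three consecutive
rungs, and the Laplacian of $\{m,\dots,n\}$ is a banded matrix indexed by rungs. Expanding its
determinant gives the weighted matrix-tree theorem (`det_eq_sum_spanningTrees`): edge sets have
squared minors 1 or 0 according to whether they are spanning trees. Reweighting finitely many edges
changes the Laplacian by a term factoring through those edges, whence window probabilities are
determinants in the transfer-current matrix (`finiteProb_eq_det`).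

Away from its ends the Laplacian is Toeplitz, with symbol $c+d|1+z|^2+|1+z+z^2|^2=c/f$ on the unit
circle. Hence $\hat f/c$ is a Green function on the whole line, and it vanishes at infinity by
Riemann–Lebesgue. The rungs alone make the quadratic form at least $c\|u\|^2$, uniformly in the size
of the subgraph. Comparing the two Green functions therefore only costs the residual at four
boundary rungs, which tends to 0 (`abs_green_sub_inv_laplacian_le`). So all window probabilities
converge. Compactness of $\{0,1\}^E$ turns the limits into a measure, and cylinder events determine
it. Between rungs the limiting transfer current is $\hat f$, which gives the determinantal formula.

For the explicit coefficients, the palindromic quartic splits into two factors $x^2-y_ix+1$, each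
with one root $x_i$ inside the unit disk and its inverse outside. The proposed combination of
$x_i^{|m|}$ and $\hat f$ both tend to 0 and solve the same inhomogeneous recurrence, and the
homogeneous one has no nonzero solution tending to 0 (`eq_zero_of_quartic`). -/

/-! ### Cauchy–Binet expansion of a weighted Gram determinant -/

open Classical in
/-- The coefficient of `∏ e ∈ S, w e` in `det (∑ e, w e • b e (b e)ᵀ)`; it is the square of the
minor of `b` with rows `S`. -/
def minorSq {ι ε : Type*} [Fintype ι] [DecidableEq ι] (b : ε → ι → ℝ) (S : Finset ε) : ℝ :=
  ∑ r ∈ (Fintype.piFinset fun _ : ι => S) with (∀ e ∈ S, ∃ i, r i = e) ∧ Function.Injective r,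
    (∏ i, b (r i) i) * (Matrix.of fun i => b (r i)).det

-- Multilinearity in the rows chooses one edge `r i` for each row. A repeated choice gives two equal
-- rows and contributes nothing; the injective choices are grouped by their image `S`.
open Classical in
theorem det_sum_smul_vecMulVec {ι ε : Type*} [Fintype ι] [DecidableEq ι] (E : Finset ε)
    (w : ε → ℝ) (b : ε → ι → ℝ) :
    (Matrix.of fun i j => ∑ e ∈ E, w e * b e i * b e j).det
      = ∑ S ∈ E.powerset, (∏ e ∈ S, w e) * minorSq b S := by
  have h1 : (Matrix.of fun i j => ∑ e ∈ E, w e * b e i * b e j).det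
      = ∑ r ∈ Fintype.piFinset (fun _ : ι => E),
        (∏ i, w (r i) * b (r i) i) * (Matrix.of fun i => b (r i)).det := by
    have h := (Matrix.detRowAlternating (n := ι) (R := ℝ)).toMultilinearMap.map_sum_finset
      (fun i e => (w e * b e i) • b e) (fun _ => E)
    simp only [MultilinearMap.map_smul_univ] at h
    refine Eq.trans ?_ h
    refine congrArg Matrix.det ?_
    ext i j
    simp [Finset.sum_apply]
  rw [h1, ← Finset.sum_filter_add_sum_filter_not _ (fun r => Function.Injective r)]
  rw [Finset.sum_eq_zero (s := Finset.filter (fun r => ¬ Function.Injective r) _), add_zero]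
  · rw [← Finset.sum_fiberwise_of_maps_to (t := E.powerset) (g := fun r => Finset.univ.image r)]
    · refine Finset.sum_congr rfl fun S hS => ?_
      rw [minorSq, Finset.mul_sum]
      have hSE := Finset.mem_powerset.1 hS
      refine Finset.sum_congr ?_ ?_
      · ext r
        simp only [Finset.mem_filter, Fintype.mem_piFinset]
        constructor
        · rintro ⟨⟨h, hi⟩, rfl⟩
          exact ⟨fun i => Finset.mem_image_of_mem _ (Finset.mem_univ _), by simp, hi⟩
        · rintro ⟨h, h2, hi⟩
          refine ⟨⟨fun i => hSE (h i), hi⟩, ?_⟩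
          ext e
          simp only [Finset.mem_image, Finset.mem_univ, true_and]
          exact ⟨fun ⟨i, h'⟩ => h' ▸ h i, h2 e⟩
      · intro r hr
        simp only [Finset.mem_filter, Fintype.mem_piFinset] at hr
        rw [Finset.prod_mul_distrib, ← mul_assoc]
        congr 2
        exact Finset.prod_bij (fun i _ => r i) (fun i _ => hr.1 i) (fun i _ j _ h => hr.2.2 h)
          (fun e he => by simpa using hr.2.1 e he) (fun _ _ => rfl)
    · intro r hr
      simp only [Finset.mem_filter, Fintype.mem_piFinset] at hr
      rw [Finset.mem_powerset]
      intro e he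
      obtain ⟨i, -, rfl⟩ := Finset.mem_image.1 he
      exact hr.1 i
  · intro r hr
    obtain ⟨i, j, hij, hne⟩ := Function.not_injective_iff.1 (Finset.mem_filter.1 hr).2
    rw [Matrix.det_zero_of_row_eq hne, mul_zero]
    ext k
    simp [hij]

-- Once `S` is enumerated by `f`, the admissible choices are the `f ∘ σ` for permutations `σ`. The
-- sign from permuting the rows combines with the diagonal product into a second Leibniz expansion
-- of the same determinant.
open Classical in
theorem minorSq_image {ι ε : Type*} [Fintype ι] [DecidableEq ι] (b : ε → ι → ℝ) (f : ι → ε)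
    (hf : Function.Injective f) {S : Finset ε} (hS : ∀ i, f i ∈ S) (hS' : ∀ e ∈ S, ∃ i, f i = e) :
    minorSq b S = (Matrix.of fun i => b (f i)).det ^ 2 := by
  rw [minorSq]
  have key : ∀ σ : Equiv.Perm ι, (Matrix.of fun i => b (f (σ i))).det
      = Equiv.Perm.sign σ * (Matrix.of fun i => b (f i)).det := fun σ =>
    Matrix.det_permute σ (Matrix.of fun i => b (f i))
  have : (Matrix.of fun i => b (f i)).det ^ 2
      = ∑ σ : Equiv.Perm ι, (∏ i, b (f (σ i)) i) * (Matrix.of fun i => b (f (σ i))).det := by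
    rw [pow_two]
    conv_lhs => rw [Matrix.det_apply' (Matrix.of fun i => b (f i))]
    rw [Finset.sum_mul]
    refine Finset.sum_congr rfl fun σ _ => ?_
    rw [key, Matrix.det_apply']
    simp only [Matrix.of_apply]
    ring
  rw [this]
  symm
  refine Finset.sum_bij (fun σ _ => f ∘ σ) ?_ ?_ ?_ ?_
  · intro σ _
    simp only [Finset.mem_filter, Fintype.mem_piFinset]
    refine ⟨fun i => hS _, fun e he => ?_, hf.comp σ.injective⟩
    obtain ⟨i, h⟩ := hS' e he
    exact ⟨σ.symm i, by simpa using h⟩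
  · intro σ _ τ _ h
    exact Equiv.ext fun i => hf (congrFun h i)
  · intro r hr
    simp only [Finset.mem_filter, Fintype.mem_piFinset] at hr
    obtain ⟨h, -, hi⟩ := hr
    replace h := fun i => hS' _ (h i)
    choose g hg using h
    have hgi : Function.Injective g := fun x y hxy => hi (by rw [← hg, ← hg, hxy])
    exact ⟨Equiv.ofBijective g (Finite.injective_iff_bijective.1 hgi), Finset.mem_univ _,
      funext fun i => by simp [hg]⟩
  · intro σ _
    rfl

/-! ### Edges in rung coordinates and the matrix-tree theorem -/

/-- The Heaviside function `k ↦ 1_{k ≤ a}`. -/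
def heaviside (a k : ℤ) : ℤ := if k ≤ a then 1 else 0

/-- The edge `{a, b}`, `a ≤ b`, as a flow along the path of all rungs: the indicator of `(a, b]`. -/
def bvec (e : Sym2 ℤ) (k : ℤ) : ℤ := heaviside e.sup k - heaviside e.inf k

/-- The indices of the rungs of the subgraph induced on `{m, …, n}`. -/
abbrev Rung (m n : ℤ) : Type := ↥(Finset.Ioc m n)

theorem sum_heaviside_mul_sub (φ : ℤ → ℝ) {m n : ℤ} {a : ℤ} (hm : m ≤ a) (hn : a ≤ n) :
    ∑ k ∈ Finset.Ioc m n, (heaviside a k : ℝ) * (φ k - φ (k - 1)) = φ a - φ m := by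
  have h1 : ∑ k ∈ Finset.Ioc m n, (heaviside a k : ℝ) * (φ k - φ (k - 1))
      = ∑ k ∈ Finset.Ioc m a, (φ k - φ (k - 1)) := by
    symm
    refine Finset.sum_subset_zero_on_sdiff (Finset.Ioc_subset_Ioc_right hn) ?_ ?_
    · intro k hk
      simp only [Finset.mem_sdiff, Finset.mem_Ioc] at hk
      have : ¬ k ≤ a := by lia
      simp [heaviside, this]
    · intro k hk
      simp only [Finset.mem_Ioc] at hk
      simp [heaviside, hk.2]
  rw [h1]
  clear h1 hn
  induction a, hm using Int.leInduction with
  | base => simp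
  | succ a ha ih =>
    rw [show Finset.Ioc m (a + 1) = insert (a + 1) (Finset.Ioc m a) by
      ext k; simp only [Finset.mem_insert, Finset.mem_Ioc]; lia, Finset.sum_insert (by simp), ih]
    simp

/-- By telescoping, the row of an edge paired with the increments of a potential is the difference
of the potential at its ends. Equal end values thus put the increments in the kernel of that row. -/
theorem sum_bvec_mul_sub (φ : ℤ → ℝ) {m n a b : ℤ} (ha : a ∈ Set.Icc m n) (hb : b ∈ Set.Icc m n)
    (h : φ a = φ b) :
    ∑ k ∈ Finset.Ioc m n, (bvec s(a, b) k : ℝ) * (φ k - φ (k - 1)) = 0 := by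
  simp only [bvec, Sym2.sup_mk, Sym2.inf_mk, Int.cast_sub, sub_mul, Finset.sum_sub_distrib]
  rcases le_total a b with hab | hab
  · rw [sup_eq_right.2 hab, inf_eq_left.2 hab, sum_heaviside_mul_sub φ hb.1 hb.2,
      sum_heaviside_mul_sub φ ha.1 ha.2, h, sub_self]
  · rw [sup_eq_left.2 hab, inf_eq_right.2 hab, sum_heaviside_mul_sub φ hb.1 hb.2,
      sum_heaviside_mul_sub φ ha.1 ha.2, h, sub_self]

/-- The rows of the matrix of the edges. -/
def row (m n : ℤ) (e : Sym2 ℤ) (i : Rung m n) : ℝ := bvec e i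

/-- The graph on `{m, …, n}` with the edges `t`. -/
abbrev graphOn (m n : ℤ) (t : Finset (Sym2 ℤ)) : SimpleGraph (Set.Icc m n) :=
  (SimpleGraph.fromEdgeSet (t : Set (Sym2 ℤ))).induce (Set.Icc m n)

theorem mem_finiteEdges {m n : ℤ} {e : Sym2 ℤ} :
    e ∈ finiteEdges m n ↔ (∀ a ∈ e, a ∈ Set.Icc m n) ∧ e ∈ edges := by
  simp [finiteEdges, Finset.mem_sym2_iff]

theorem not_isDiag_of_mem_edges {e : Sym2 ℤ} (h : e ∈ edges) : ¬ e.IsDiag := by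
  rcases h with (⟨k, rfl⟩ | ⟨k, rfl⟩) | ⟨k, rfl⟩ <;>
    simp only [zEdge, gEdge, hEdge, Sym2.mk_isDiag_iff] <;> lia

theorem card_edgeSet_graphOn {m n : ℤ} {t : Finset (Sym2 ℤ)} (ht : t ⊆ finiteEdges m n) :
    Nat.card (graphOn m n t).edgeSet = t.card := by
  have hinj : Function.Injective (Sym2.map (Subtype.val : Set.Icc m n → ℤ)) :=
    Sym2.map.injective Subtype.val_injective
  have : Sym2.map (Subtype.val : Set.Icc m n → ℤ) '' (graphOn m n t).edgeSet = t := by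
    ext e
    constructor
    · rintro ⟨f, hf, rfl⟩
      induction f with | _ a b =>
      simp only [SimpleGraph.mem_edgeSet, SimpleGraph.comap_adj, SimpleGraph.fromEdgeSet_adj] at hf
      exact hf.1
    · intro he
      have h := mem_finiteEdges.1 (ht he)
      have hd := not_isDiag_of_mem_edges h.2
      induction e with | _ a b =>
      refine ⟨s(⟨a, h.1 a (by simp)⟩, ⟨b, h.1 b (by simp)⟩), ?_, rfl⟩
      simp only [SimpleGraph.mem_edgeSet, SimpleGraph.comap_adj, SimpleGraph.fromEdgeSet_adj]
      exact ⟨he, by simpa using hd⟩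
  rw [← Set.ncard_coe_finset, ← this, Set.ncard_image_of_injective _ hinj]
  rfl

/-- The indicator of a connected component takes equal values at the ends of every edge of `t`, so
its increments form a kernel vector. The vector is nonzero because the indicator is not constant. -/
theorem det_eq_zero_of_not_connected {m n : ℤ} (hmn : m ≤ n) {t : Finset (Sym2 ℤ)}
    (ht : t ⊆ finiteEdges m n) (hc : ¬ (graphOn m n t).Connected)
    (f : Rung m n → Sym2 ℤ) (hf : ∀ i, f i ∈ t) : (Matrix.of fun i => row m n (f i)).det = 0 := by
  classical
  have hne : Nonempty (Set.Icc m n) := ⟨⟨m, le_refl _, hmn⟩⟩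
  have : ¬ (graphOn m n t).Preconnected := fun h => hc ⟨h⟩
  simp only [SimpleGraph.Preconnected] at this
  push Not at this
  obtain ⟨u, v, huv⟩ := this
  set φ : ℤ → ℝ := fun k => if h : k ∈ Set.Icc m n then
    (if (graphOn m n t).Reachable u ⟨k, h⟩ then 1 else 0) else 0 with hφ
  have hval : ∀ x : Set.Icc m n, φ x = if (graphOn m n t).Reachable u x then 1 else 0 := by
    intro x
    simp only [hφ, dif_pos x.2]
  have hu : φ u = 1 := by rw [hval]; simp
  have hv : φ v = 0 := by rw [hval]; simp [huv]
  rw [← Matrix.exists_mulVec_eq_zero_iff]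
  refine ⟨fun i => φ i - φ (i - 1), ?_, ?_⟩
  · intro h0
    have hz : ∀ a ∈ Set.Icc m n, φ a - φ m = 0 := by
      intro a ha
      rw [← sum_heaviside_mul_sub φ ha.1 ha.2]
      refine Finset.sum_eq_zero fun k hk => ?_
      have := congrFun h0 ⟨k, hk⟩
      simp only [Pi.zero_apply] at this
      rw [this, mul_zero]
    have h1 := hz u u.2
    have h2 := hz v v.2
    linarith
  · funext i
    have h := mem_finiteEdges.1 (ht (hf i))
    have hd := not_isDiag_of_mem_edges h.2
    have hi := hf i
    simp only [Matrix.mulVec, dotProduct, Matrix.of_apply, row, Pi.zero_apply]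
    generalize f i = e at *
    induction e with | _ a b =>
    rw [Finset.sum_coe_sort (Finset.Ioc m n)
      (fun k => (bvec s(a, b) k : ℝ) * (φ k - φ (k - 1)))]
    have ha := h.1 a (by simp)
    have hb := h.1 b (by simp)
    refine sum_bvec_mul_sub φ ha hb ?_
    have hadj : (graphOn m n t).Adj ⟨a, ha⟩ ⟨b, hb⟩ := by
      simp only [SimpleGraph.comap_adj, SimpleGraph.fromEdgeSet_adj]
      exact ⟨hi, by simpa using hd⟩
    have e1 := hval ⟨a, ha⟩
    have e2 := hval ⟨b, hb⟩
    simp only at e1 e2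
    rw [e1, e2]
    have : (graphOn m n t).Reachable u ⟨a, ha⟩ ↔ (graphOn m n t).Reachable u ⟨b, hb⟩ :=
      ⟨fun h => h.trans hadj.reachable, fun h => h.trans hadj.reachable.symm⟩
    simp [this]

/-- A path from `j - 1` to `j` writes the `j`-th unit vector as an integer combination of rows. The
integer matrix thus has an integer left inverse, and its determinant is ±1. -/
theorem det_sq_eq_one_of_connected {m n : ℤ} {t : Finset (Sym2 ℤ)}
    (hc : (graphOn m n t).Connected) (f : Rung m n → Sym2 ℤ)
    (hf : ∀ e ∈ t, ∃ i, f i = e) : (Matrix.of fun i => row m n (f i)).det ^ 2 = 1 := by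
  classical
  set B : Matrix (Rung m n) (Rung m n) ℤ := Matrix.of fun i k => bvec (f i) k with hB
  have hBi : ∀ i k, B i k = bvec (f i) k := fun _ _ => rfl
  have hspan : ∀ u v : Set.Icc m n, (graphOn m n t).Reachable u v →
      ∃ x : Rung m n → ℤ, ∀ k : Rung m n,
        ∑ i, x i * B i k = heaviside v k - heaviside u k := by
    rintro u v ⟨p⟩
    induction p with
    | nil => exact ⟨0, fun k => by simp⟩
    | @cons u v w hadj p ih =>
      obtain ⟨x, hx⟩ := ih
      have he : s((u : ℤ), (v : ℤ)) ∈ t := by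
        simp only [SimpleGraph.comap_adj, SimpleGraph.fromEdgeSet_adj] at hadj
        exact hadj.1
      obtain ⟨i, hi⟩ := hf _ he
      rcases le_total (u : ℤ) v with huv | huv
      · refine ⟨x + Pi.single i 1, fun k => ?_⟩
        simp only [Pi.add_apply, add_mul, Finset.sum_add_distrib, hx k, Pi.single_apply, ite_mul,
          one_mul, zero_mul, Finset.sum_ite_eq', Finset.mem_univ, if_true]
        simp only [hBi, hi, bvec, Sym2.sup_mk, Sym2.inf_mk, sup_eq_right.2 huv, inf_eq_left.2 huv]
        ring
      · refine ⟨x - Pi.single i 1, fun k => ?_⟩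
        simp only [Pi.sub_apply, sub_mul, Finset.sum_sub_distrib, hx k, Pi.single_apply, ite_mul,
          one_mul, zero_mul, Finset.sum_ite_eq', Finset.mem_univ, if_true]
        simp only [hBi, hi, bvec, Sym2.sup_mk, Sym2.inf_mk, sup_eq_left.2 huv, inf_eq_right.2 huv]
        ring
  have hrow : ∀ j : Rung m n, ∃ x : Rung m n → ℤ, ∀ k : Rung m n,
      ∑ i, x i * B i k = (1 : Matrix (Rung m n) (Rung m n) ℤ) j k := by
    intro j
    have hj := Finset.mem_Ioc.1 j.2
    obtain ⟨x, hx⟩ := hspan ⟨j - 1, by constructor <;> lia⟩ ⟨j, by constructor <;> lia⟩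
      (hc.preconnected _ _)
    refine ⟨x, fun k => ?_⟩
    rw [hx, Matrix.one_apply, heaviside, heaviside]
    simp only [Subtype.ext_iff]
    split_ifs <;> lia
  choose C hC using hrow
  have hCB : Matrix.of C * B = 1 := by
    ext j k
    rw [Matrix.mul_apply, ← hC j k]
    rfl
  have hdet : B.det ^ 2 = 1 := by
    have h := congrArg Matrix.det hCB
    rw [Matrix.det_mul, Matrix.det_one] at h
    have hu : IsUnit B.det := IsUnit.of_mul_eq_one_right _ h
    rcases Int.isUnit_iff.1 hu with h | h <;> rw [h] <;> norm_num
  have : (Matrix.of fun i => row m n (f i)) = B.map (Int.castRingHom ℝ) := by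
    ext i k
    simp [row, hB]
  rw [this, ← RingHom.mapMatrix_apply, ← RingHom.map_det, ← map_pow, hdet, map_one]

/-- With as many edges as rungs, being a tree is the same as being connected. With any other number
of edges there is no bijective choice of rows, and no tree either. -/
theorem minorSq_row {m n : ℤ} (hmn : m ≤ n) {t : Finset (Sym2 ℤ)} (ht : t ⊆ finiteEdges m n)
    [Decidable (graphOn m n t).IsTree] :
    minorSq (row m n) t = if (graphOn m n t).IsTree then 1 else 0 := by
  classical
  have hcard : Nat.card (Set.Icc m n) = Fintype.card (Rung m n) + 1 := by
    simp only [Nat.card_eq_fintype_card, Fintype.card_coe, Int.card_Ioc, Fintype.card_ofFinset,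
      Int.card_Icc]
    lia
  by_cases htc : t.card = Fintype.card (Rung m n)
  · obtain ⟨σ⟩ : Nonempty (Rung m n ≃ t) := ⟨Fintype.equivOfCardEq (by simp [← htc])⟩
    rw [minorSq_image (row m n) (fun i => (σ i : Sym2 ℤ))
      (Subtype.val_injective.comp σ.injective) (fun i => (σ i).2)
      (fun e he => ⟨σ.symm ⟨e, he⟩, by simp⟩)]
    have hiff : (graphOn m n t).IsTree ↔ (graphOn m n t).Connected := by
      rw [SimpleGraph.isTree_iff_connected_and_card, card_edgeSet_graphOn ht, hcard, htc]
      simp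
    split_ifs with h
    · exact det_sq_eq_one_of_connected (hiff.1 h) _ fun e he => ⟨σ.symm ⟨e, he⟩, by simp⟩
    · rw [det_eq_zero_of_not_connected hmn ht (fun hc => h (hiff.2 hc)) _
        (fun i => (σ i).2)]
      norm_num
  · have hnt : ¬ (graphOn m n t).IsTree := by
      rw [SimpleGraph.isTree_iff_connected_and_card, card_edgeSet_graphOn ht, hcard]
      lia
    rw [if_neg hnt, minorSq]
    refine Finset.sum_eq_zero fun r hr => ?_
    simp only [Finset.mem_filter, Fintype.mem_piFinset] at hr
    refine absurd ?_ htc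
    exact (Finset.card_bij (fun i _ => r i) (fun i _ => hr.1 i) (fun i _ j _ h => hr.2.2 h)
      (fun e he => by simpa using hr.2.1 e he)).symm

/-- The **weighted matrix-tree theorem** for the subgraph induced on `{m, …, n}`, in the basis of
the rungs. -/
theorem det_eq_sum_spanningTrees {m n : ℤ} (hmn : m ≤ n) (w : Sym2 ℤ → ℝ) :
    (Matrix.of fun i j => ∑ e ∈ finiteEdges m n, w e * row m n e i * row m n e j).det
      = ∑ t ∈ spanningTrees m n, ∏ e ∈ t, w e := by
  classical
  rw [det_sum_smul_vecMulVec, spanningTrees, Finset.sum_filter]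
  refine Finset.sum_congr rfl fun t ht => ?_
  rw [minorSq_row hmn (Finset.mem_powerset.1 ht)]
  simp

/-! ### The Laplacian, the edges it is built from, and coercivity -/

/-- The weighted Laplacian of the subgraph induced on `{m, …, n}` in the basis of the rungs. -/
def laplacian (c d : ℝ) (m n : ℤ) : Matrix (Rung m n) (Rung m n) ℝ :=
  Matrix.of fun i j => ∑ e ∈ finiteEdges m n, edgeWeight c d e * row m n e i * row m n e j

open Classical in
/-- The edge weights of the subgraph induced on `{m, …, n}`. -/
def localWeight (c d : ℝ) (m n : ℤ) (e : Sym2 ℤ) : ℝ :=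
  if e ∈ finiteEdges m n then edgeWeight c d e else 0

/-- The transfer-current matrix of the subgraph induced on `{m, …, n}`. -/
def transfer (c d : ℝ) (m n : ℤ) (e f : Sym2 ℤ) : ℝ :=
  localWeight c d m n e *
    ∑ i, ∑ j, row m n e i * (laplacian c d m n)⁻¹ i j * row m n f j

theorem bvec_zEdge (m k : ℤ) : bvec (zEdge m) k = if k = m then 1 else 0 := by
  have h1 : (zEdge m).sup = m := sup_eq_right.2 (by lia)
  have h2 : (zEdge m).inf = m - 1 := inf_eq_left.2 (by lia)
  simp only [bvec, heaviside, h1, h2]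
  split_ifs <;> lia

theorem bvec_gEdge (m k : ℤ) : bvec (gEdge m) k = if k = m ∨ k = m - 1 then 1 else 0 := by
  have h1 : (gEdge m).sup = m := sup_eq_right.2 (by lia)
  have h2 : (gEdge m).inf = m - 2 := inf_eq_left.2 (by lia)
  simp only [bvec, heaviside, h1, h2]
  split_ifs <;> lia

theorem bvec_hEdge (m k : ℤ) :
    bvec (hEdge m) k = if k = m ∨ k = m - 1 ∨ k = m - 2 then 1 else 0 := by
  have h1 : (hEdge m).sup = m := sup_eq_right.2 (by lia)
  have h2 : (hEdge m).inf = m - 3 := inf_eq_left.2 (by lia)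
  simp only [bvec, heaviside, h1, h2]
  split_ifs <;> lia

theorem zEdge_injective : Function.Injective zEdge := fun a b h => by
  simp only [zEdge, Sym2.eq_iff] at h; lia

theorem gEdge_injective : Function.Injective gEdge := fun a b h => by
  simp only [gEdge, Sym2.eq_iff] at h; lia

theorem hEdge_injective : Function.Injective hEdge := fun a b h => by
  simp only [hEdge, Sym2.eq_iff] at h; lia

theorem zEdge_ne_gEdge (a b : ℤ) : zEdge a ≠ gEdge b := fun h => by
  simp only [zEdge, gEdge, Sym2.eq_iff] at h; lia

theorem zEdge_ne_hEdge (a b : ℤ) : zEdge a ≠ hEdge b := fun h => by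
  simp only [zEdge, hEdge, Sym2.eq_iff] at h; lia

theorem gEdge_ne_hEdge (a b : ℤ) : gEdge a ≠ hEdge b := fun h => by
  simp only [gEdge, hEdge, Sym2.eq_iff] at h; lia

theorem edgeWeight_zEdge (c d : ℝ) (m : ℤ) : edgeWeight c d (zEdge m) = c := by
  simp [edgeWeight]

theorem edgeWeight_gEdge (c d : ℝ) (m : ℤ) : edgeWeight c d (gEdge m) = d := by
  simp [edgeWeight, zEdge_ne_gEdge]

theorem edgeWeight_hEdge (c d : ℝ) (m : ℤ) : edgeWeight c d (hEdge m) = 1 := by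
  simp [edgeWeight, zEdge_ne_hEdge, gEdge_ne_hEdge]

theorem edgeWeight_nonneg {c d : ℝ} (hc : 0 < c) (hd : 0 ≤ d) (e : Sym2 ℤ) :
    0 ≤ edgeWeight c d e := by
  rw [edgeWeight]
  split_ifs <;> linarith

theorem edgeWeight_of_notMem (c d : ℝ) {e : Sym2 ℤ} (he : e ∉ edges) : edgeWeight c d e = 0 := by
  simp only [edges, Set.mem_union, not_or] at he
  rw [edgeWeight, if_neg he.1.1, if_neg he.1.2, if_neg he.2]

theorem zEdge_mem_finiteEdges {m n k : ℤ} : zEdge k ∈ finiteEdges m n ↔ k ∈ Finset.Ioc m n := by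
  rw [mem_finiteEdges, and_iff_left (show zEdge k ∈ edges from Or.inl (Or.inl ⟨k, rfl⟩))]
  simp only [zEdge, Sym2.mem_iff, forall_eq_or_imp, forall_eq, Set.mem_Icc, Finset.mem_Ioc]
  lia

theorem gEdge_mem_finiteEdges {m n k : ℤ} :
    gEdge k ∈ finiteEdges m n ↔ k ∈ Finset.Ioc (m + 1) n := by
  rw [mem_finiteEdges, and_iff_left (show gEdge k ∈ edges from Or.inl (Or.inr ⟨k, rfl⟩))]
  simp only [gEdge, Sym2.mem_iff, forall_eq_or_imp, forall_eq, Set.mem_Icc, Finset.mem_Ioc]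
  lia

theorem hEdge_mem_finiteEdges {m n k : ℤ} :
    hEdge k ∈ finiteEdges m n ↔ k ∈ Finset.Ioc (m + 2) n := by
  rw [mem_finiteEdges, and_iff_left (show hEdge k ∈ edges from Or.inr ⟨k, rfl⟩)]
  simp only [hEdge, Sym2.mem_iff, forall_eq_or_imp, forall_eq, Set.mem_Icc, Finset.mem_Ioc]
  lia

theorem sum_finiteEdges (m n : ℤ) (F : Sym2 ℤ → ℝ) :
    ∑ e ∈ finiteEdges m n, F e = ∑ k ∈ Finset.Ioc m n, F (zEdge k)
      + ∑ k ∈ Finset.Ioc (m + 1) n, F (gEdge k) + ∑ k ∈ Finset.Ioc (m + 2) n, F (hEdge k) := by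
  classical
  have : finiteEdges m n = ((Finset.Ioc m n).image zEdge ∪ (Finset.Ioc (m + 1) n).image gEdge)
      ∪ (Finset.Ioc (m + 2) n).image hEdge := by
    ext e
    simp only [Finset.mem_union, Finset.mem_image]
    constructor
    · intro h
      rcases (mem_finiteEdges.1 h).2 with (⟨k, rfl⟩ | ⟨k, rfl⟩) | ⟨k, rfl⟩
      · exact Or.inl (Or.inl ⟨k, zEdge_mem_finiteEdges.1 h, rfl⟩)
      · exact Or.inl (Or.inr ⟨k, gEdge_mem_finiteEdges.1 h, rfl⟩)
      · exact Or.inr ⟨k, hEdge_mem_finiteEdges.1 h, rfl⟩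
    · rintro ((⟨k, hk, rfl⟩ | ⟨k, hk, rfl⟩) | ⟨k, hk, rfl⟩)
      · exact zEdge_mem_finiteEdges.2 hk
      · exact gEdge_mem_finiteEdges.2 hk
      · exact hEdge_mem_finiteEdges.2 hk
  rw [this, Finset.sum_union, Finset.sum_union, Finset.sum_image fun _ _ _ _ h => zEdge_injective h,
    Finset.sum_image fun _ _ _ _ h => gEdge_injective h,
    Finset.sum_image fun _ _ _ _ h => hEdge_injective h]
  · rw [Finset.disjoint_left]
    simp only [Finset.mem_image, not_exists, not_and, forall_exists_index, and_imp]
    rintro _ k - rfl l - h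
    exact zEdge_ne_gEdge k l h.symm
  · rw [Finset.disjoint_left]
    simp only [Finset.mem_union, Finset.mem_image, not_exists, not_and]
    rintro _ (⟨k, -, rfl⟩ | ⟨k, -, rfl⟩) l - h
    · exact zEdge_ne_hEdge k l h.symm
    · exact gEdge_ne_hEdge k l h.symm

theorem dotProduct_laplacian_mulVec (c d : ℝ) (m n : ℤ) (u : Rung m n → ℝ) :
    u ⬝ᵥ (laplacian c d m n).mulVec u
      = ∑ e ∈ finiteEdges m n, edgeWeight c d e * (∑ i, row m n e i * u i) ^ 2 := by
  simp only [dotProduct, Matrix.mulVec, laplacian, Matrix.of_apply, Finset.sum_mul,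
    Finset.mul_sum, pow_two]
  conv_lhs => enter [2, i]; rw [Finset.sum_comm]
  rw [Finset.sum_comm]
  refine Finset.sum_congr rfl fun e _ => Finset.sum_congr rfl fun i _ =>
    Finset.sum_congr rfl fun j _ => ?_
  ring

/-- The rungs contribute exactly the left-hand side, and the other edges contribute nonnegative
terms. The constant does not depend on `m` and `n`, which later makes the boundary estimate uniform.
-/
theorem le_dotProduct_laplacian_mulVec {c d : ℝ} (hc : 0 < c) (hd : 0 ≤ d) (m n : ℤ)
    (u : Rung m n → ℝ) : c * ∑ i, u i ^ 2 ≤ u ⬝ᵥ (laplacian c d m n).mulVec u := by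
  rw [dotProduct_laplacian_mulVec, sum_finiteEdges]
  have h1 : c * ∑ i, u i ^ 2 = ∑ k ∈ Finset.Ioc m n,
      edgeWeight c d (zEdge k) * (∑ i, row m n (zEdge k) i * u i) ^ 2 := by
    rw [← Finset.sum_coe_sort (Finset.Ioc m n), Finset.mul_sum]
    refine Finset.sum_congr rfl fun k _ => ?_
    have : ∑ i, row m n (zEdge k) i * u i = u k := by
      simp [row, bvec_zEdge]
    rw [this, edgeWeight_zEdge]
  rw [h1, add_assoc]
  refine le_add_of_nonneg_right (add_nonneg ?_ ?_) <;>
    exact Finset.sum_nonneg fun k _ => mul_nonneg (edgeWeight_nonneg hc hd _) (sq_nonneg _)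

theorem det_laplacian_ne_zero {c d : ℝ} (hc : 0 < c) (hd : 0 ≤ d) (m n : ℤ) :
    (laplacian c d m n).det ≠ 0 := by
  intro h
  obtain ⟨u, hu, hu0⟩ := Matrix.exists_mulVec_eq_zero_iff.2 h
  have h1 := le_dotProduct_laplacian_mulVec hc hd m n u
  rw [hu0, dotProduct_zero] at h1
  have h2 : ∑ i, u i ^ 2 ≤ 0 := by
    by_contra! h2
    have := mul_pos hc h2
    linarith
  refine hu (funext fun i => ?_)
  have h3 := (Finset.sum_eq_zero_iff_of_nonneg fun i _ => sq_nonneg (u i)).1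
    (le_antisymm h2 (Finset.sum_nonneg fun i _ => sq_nonneg (u i))) i (Finset.mem_univ i)
  simpa using h3

/-! ### Transfer-current determinants for finite subgraphs -/

-- The product multiplies the weight of `ε i` by `a i`, which perturbs the Laplacian by $V^{T}DV$,
-- where the rows of $V$ belong to the chosen edges. Factoring out the Laplacian and using
-- $\det(1+XY)=\det(1+YX)$ reduces to a determinant of size `κ`.
open Classical in
theorem sum_treeWeight_mul_prod_ite {c d : ℝ} (hc : 0 < c) (hd : 0 ≤ d) {m n : ℤ} (hmn : m ≤ n)
    {κ : Type*} [Fintype κ] [DecidableEq κ] (ε : κ → Sym2 ℤ) (hε : Function.Injective ε)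
    (a : κ → ℝ) :
    ∑ t ∈ spanningTrees m n, treeWeight c d t * ∏ i, (if ε i ∈ t then a i else 1)
      = (laplacian c d m n).det * (1 + Matrix.diagonal (fun i => a i - 1) *
        Matrix.of fun i j => transfer c d m n (ε i) (ε j)).det := by
  set w : Sym2 ℤ → ℝ := fun e => edgeWeight c d e * ∏ i, (if ε i = e then a i else 1) with hw
  have h1 : ∀ t : Finset (Sym2 ℤ),
      treeWeight c d t * ∏ i, (if ε i ∈ t then a i else 1) = ∏ e ∈ t, w e := by
    intro t
    rw [hw, Finset.prod_mul_distrib, treeWeight, Finset.prod_comm]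
    simp
  have h2 : ∀ e, ∏ i, (if ε i = e then a i else 1)
      = 1 + ∑ i, (if ε i = e then a i - 1 else 0) := by
    intro e
    by_cases he : ∃ k, ε k = e
    · obtain ⟨k, rfl⟩ := he
      simp [hε.eq_iff]
    · push Not at he
      simp [he]
  set V : Matrix κ (Rung m n) ℝ := Matrix.of fun i => row m n (ε i) with hV
  set D : Matrix κ κ ℝ := Matrix.diagonal fun i => (a i - 1) * localWeight c d m n (ε i) with hD
  have h3 : (Matrix.of fun i j => ∑ e ∈ finiteEdges m n, w e * row m n e i * row m n e j)
      = laplacian c d m n + V.transpose * (D * V) := by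
    ext i j
    rw [Matrix.add_apply, Matrix.mul_apply]
    simp only [hD, Matrix.diagonal_mul]
    simp only [Matrix.of_apply, laplacian, Matrix.transpose_apply, hV]
    simp only [hw, h2, mul_add, add_mul, Finset.sum_add_distrib, mul_one, Finset.mul_sum,
      Finset.sum_mul]
    congr 1
    rw [Finset.sum_comm]
    refine Finset.sum_congr rfl fun k _ => ?_
    simp only [mul_ite, mul_zero, ite_mul, zero_mul, Finset.sum_ite_eq, localWeight]
    split_ifs <;> ring
  have hL : IsUnit (laplacian c d m n).det := (det_laplacian_ne_zero hc hd m n).isUnit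
  rw [Finset.sum_congr rfl fun t _ => h1 t, ← det_eq_sum_spanningTrees hmn, h3]
  have h4 : laplacian c d m n + V.transpose * (D * V)
      = laplacian c d m n * (1 + ((laplacian c d m n)⁻¹ * V.transpose) * (D * V)) := by
    rw [mul_add, mul_one, Matrix.mul_assoc, Matrix.mul_nonsing_inv_cancel_left _ _ hL]
  rw [h4, Matrix.det_mul, Matrix.det_one_add_mul_comm]
  congr 3
  ext i j
  rw [Matrix.diagonal_mul, Matrix.mul_assoc, hD, Matrix.diagonal_mul, Matrix.of_apply, transfer,
    mul_assoc]
  congr 2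
  simp only [Matrix.mul_apply, Matrix.transpose_apply, hV, Matrix.of_apply, Finset.mul_sum,
    mul_assoc]

open Classical in
theorem sum_treeWeight_mul_prod_ite_ite {c d : ℝ} (hc : 0 < c) (hd : 0 ≤ d) {m n : ℤ}
    (hmn : m ≤ n) {κ : Type*} [Fintype κ] [DecidableEq κ] (ε : κ → Sym2 ℤ)
    (hε : Function.Injective ε) (a b : κ → ℝ) :
    ∑ t ∈ spanningTrees m n, treeWeight c d t * ∏ i, (if ε i ∈ t then a i else b i)
      = (laplacian c d m n).det * (Matrix.diagonal b + Matrix.diagonal (fun i => a i - b i) *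
        Matrix.of fun i j => transfer c d m n (ε i) (ε j)).det := by
  have hne : ∀ b : κ → ℝ, (∀ i, b i ≠ 0) →
      ∑ t ∈ spanningTrees m n, treeWeight c d t * ∏ i, (if ε i ∈ t then a i else b i)
      = (laplacian c d m n).det * (Matrix.diagonal b + Matrix.diagonal (fun i => a i - b i) *
        Matrix.of fun i j => transfer c d m n (ε i) (ε j)).det := by
    intro b hb
    have h1 : Matrix.diagonal b + Matrix.diagonal (fun i => a i - b i) *
        (Matrix.of fun i j => transfer c d m n (ε i) (ε j))
        = Matrix.diagonal b * (1 + Matrix.diagonal (fun i => a i / b i - 1) *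
        Matrix.of fun i j => transfer c d m n (ε i) (ε j)) := by
      rw [mul_add, mul_one, ← Matrix.mul_assoc, Matrix.diagonal_mul_diagonal]
      congr 3
      ext i
      field_simp [hb i]
    rw [h1, Matrix.det_mul, mul_left_comm, ← sum_treeWeight_mul_prod_ite hc hd hmn ε hε,
      Matrix.det_diagonal, Finset.mul_sum]
    refine Finset.sum_congr rfl fun t _ => ?_
    rw [mul_left_comm, ← Finset.prod_mul_distrib]
    congr 1
    refine Finset.prod_congr rfl fun i _ => ?_
    split_ifs
    · field_simp [hb i]
    · rw [mul_one]
  -- The reduction to the previous lemma divides by `b i`. To allow zeros, `b` is shifted by a small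
  -- `s ≠ 0`, and `s → 0` by continuity of both sides.
  set L : ℝ → ℝ := fun s => ∑ t ∈ spanningTrees m n,
    treeWeight c d t * ∏ i, (if ε i ∈ t then a i else b i + s)
  set R : ℝ → ℝ := fun s => (laplacian c d m n).det *
    (Matrix.diagonal (fun i => b i + s) + Matrix.diagonal (fun i => a i - (b i + s)) *
        Matrix.of fun i j => transfer c d m n (ε i) (ε j)).det
  have hL : Continuous L := by
    refine continuous_finsetSum _ fun t _ => continuous_const.mul
      (continuous_finsetProd _ fun i _ => ?_)
    split_ifs <;> fun_prop
  have hR : Continuous R := by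
    refine continuous_const.mul (Continuous.matrix_det ?_)
    refine Continuous.add (Continuous.matrix_diagonal (by fun_prop))
      (Continuous.mul (Continuous.matrix_diagonal (by fun_prop)) continuous_const)
  have hev : ∀ᶠ s in 𝓝[≠] (0 : ℝ), L s = R s := by
    have : ∀ᶠ s in 𝓝[≠] (0 : ℝ), ∀ i, b i + s ≠ 0 := by
      rw [Filter.eventually_all]
      intro i
      by_cases hi : b i = 0
      · filter_upwards [self_mem_nhdsWithin] with s hs
        simpa [hi] using hs
      · refine nhdsWithin_le_nhds ?_
        have : ContinuousAt (fun s => b i + s) 0 := by fun_prop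
        exact this.eventually_ne (by simpa using hi)
    filter_upwards [this] with s hs using hne _ hs
  have h0 : L 0 = R 0 :=
    tendsto_nhds_unique_of_eventuallyEq (hL.continuousAt.tendsto.mono_left nhdsWithin_le_nhds)
      (hR.continuousAt.tendsto.mono_left nhdsWithin_le_nhds) hev
  simpa [L, R] using h0

-- Taking `a` and `b` to be the indicators of `B` and of its complement makes the product over `κ`
-- the indicator of the event.
open Classical in
theorem finiteProb_eq_det {c d : ℝ} (hc : 0 < c) (hd : 0 ≤ d) (n : ℕ)
    {κ : Type*} [Fintype κ] [DecidableEq κ] (ε : κ → Sym2 ℤ) (hε : Function.Injective ε)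
    (B : Set (Sym2 ℤ)) :
    finiteProb c d n {T | ∀ i, ε i ∈ T ↔ ε i ∈ B}
      = (Matrix.diagonal (fun i => if ε i ∈ B then (0 : ℝ) else 1)
        + Matrix.diagonal (fun i => if ε i ∈ B then (1 : ℝ) else -1) *
        Matrix.of fun i j => transfer c d (-n) n (ε i) (ε j)).det := by
  have hmn : (-n : ℤ) ≤ n := by lia
  have hZ : ∑ t ∈ spanningTrees (-n) n, treeWeight c d t = (laplacian c d (-n) n).det := by
    rw [laplacian, det_eq_sum_spanningTrees hmn]
    rfl
  have h := sum_treeWeight_mul_prod_ite_ite hc hd hmn ε hε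
    (fun i => if ε i ∈ B then 1 else 0) (fun i => if ε i ∈ B then 0 else 1)
  rw [finiteProb, hZ, div_eq_iff (det_laplacian_ne_zero hc hd _ _), mul_comm]
  have h2 : (fun i => (if ε i ∈ B then (1 : ℝ) else 0) - (if ε i ∈ B then 0 else 1))
      = fun i => if ε i ∈ B then (1 : ℝ) else -1 := by
    ext i
    split_ifs <;> norm_num
  rw [← h2, ← h, Finset.sum_filter]
  refine Finset.sum_congr rfl fun t _ => ?_
  simp only [Set.mem_ofPred_eq, Finset.mem_coe]
  split_ifs with ht
  · rw [Finset.prod_eq_one, mul_one]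
    intro i _
    by_cases hi : ε i ∈ B
    · rw [if_pos ((ht i).2 hi), if_pos hi]
    · rw [if_neg (fun h => hi ((ht i).1 h)), if_neg hi]
  · push Not at ht
    obtain ⟨i, hi⟩ := ht
    rw [Finset.prod_eq_zero (Finset.mem_univ i), mul_zero]
    rcases hi with hi | hi
    · rw [if_pos hi.1, if_neg hi.2]
    · rw [if_neg hi.1, if_pos hi.2]

/-! ### The symbol, its Fourier coefficients and the Green function on the line -/

/-- With $t=\cos 2\pi x$ the denominator minus $c$ equals $2d(1+t)+(1+2t)^2$. -/
theorem le_symbol_denom {c d : ℝ} (hd : 0 ≤ d) (x : ℝ) :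
    c ≤ (c + 2 * d + 3) + 2 * (d + 2) * Real.cos (2 * Real.pi * x)
      + 2 * Real.cos (4 * Real.pi * x) := by
  have h : Real.cos (4 * Real.pi * x) = 2 * Real.cos (2 * Real.pi * x) ^ 2 - 1 := by
    rw [← Real.cos_two_mul]; ring_nf
  rw [h]
  have h1 := mul_nonneg hd (by linarith [Real.neg_one_le_cos (2 * Real.pi * x)] :
    0 ≤ 1 + Real.cos (2 * Real.pi * x))
  nlinarith [sq_nonneg (1 + 2 * Real.cos (2 * Real.pi * x))]

theorem symbol_pos {c d : ℝ} (hc : 0 < c) (hd : 0 ≤ d) (x : ℝ) : 0 < symbol c d x :=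
  div_pos hc (hc.trans_le (le_symbol_denom hd x))

theorem symbol_le_one {c d : ℝ} (hc : 0 < c) (hd : 0 ≤ d) (x : ℝ) : symbol c d x ≤ 1 :=
  (div_le_one (hc.trans_le (le_symbol_denom hd x))).2 (le_symbol_denom hd x)

theorem continuous_symbol {c d : ℝ} (hc : 0 < c) (hd : 0 ≤ d) : Continuous (symbol c d) :=
  Continuous.div continuous_const (by fun_prop) fun x =>
    (hc.trans_le (le_symbol_denom hd x)).ne'

theorem symbol_one_sub (c d x : ℝ) : symbol c d (1 - x) = symbol c d x := by
  have h1 : Real.cos (2 * Real.pi * (1 - x)) = Real.cos (2 * Real.pi * x) := by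
    rw [show 2 * Real.pi * (1 - x) = 2 * Real.pi - 2 * Real.pi * x by ring, Real.cos_two_pi_sub]
  have h2 : Real.cos (4 * Real.pi * (1 - x)) = Real.cos (4 * Real.pi * x) := by
    rw [show 4 * Real.pi * (1 - x) = 2 * Real.pi - 4 * Real.pi * x + 2 * Real.pi by ring,
      Real.cos_add_two_pi, Real.cos_two_pi_sub]
  rw [symbol, symbol, h1, h2]

theorem fourierHat_eq_intervalIntegral (f : ℝ → ℝ) (k : ℤ) :
    fourierHat f k = ∫ x in (0 : ℝ)..1, (f x : ℂ) * Complex.exp (-2 * Real.pi * Complex.I * k * x) := by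
  rw [fourierHat, intervalIntegral.integral_of_le zero_le_one, integral_Icc_eq_integral_Ioc]

theorem fourierHat_neg_of_one_sub {f : ℝ → ℝ} (hf : ∀ x, f (1 - x) = f x) (k : ℤ) :
    fourierHat f (-k) = fourierHat f k := by
  rw [fourierHat_eq_intervalIntegral, fourierHat_eq_intervalIntegral]
  have h := intervalIntegral.integral_comp_sub_left (a := 0) (b := 1)
    (fun x : ℝ => (f x : ℂ) * Complex.exp (-2 * Real.pi * Complex.I * k * x)) 1
  simp only [sub_self, sub_zero] at h
  rw [← h]
  congr 1
  ext x
  rw [hf]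
  congr 1
  rw [Complex.exp_eq_exp_iff_exists_int]
  exact ⟨k, by push_cast; ring⟩

theorem conj_fourierHat (f : ℝ → ℝ) (k : ℤ) :
    (starRingEnd ℂ) (fourierHat f k) = fourierHat f (-k) := by
  rw [fourierHat, fourierHat, ← integral_conj]
  congr 1
  ext x
  rw [map_mul, ← Complex.exp_conj, Complex.conj_ofReal]
  simp only [map_mul, map_neg, map_ofNat, Complex.conj_ofReal, Complex.conj_I, map_intCast]
  push_cast
  ring_nf

theorem fourierHat_symbol_neg (c d : ℝ) (k : ℤ) :
    fourierHat (symbol c d) (-k) = fourierHat (symbol c d) k :=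
  fourierHat_neg_of_one_sub (symbol_one_sub c d) k

theorem fourierHat_symbol_im (c d : ℝ) (k : ℤ) : (fourierHat (symbol c d) k).im = 0 := by
  rw [← Complex.conj_eq_iff_im, conj_fourierHat, fourierHat_symbol_neg]

/-- This is the Riemann–Lebesgue lemma for `f` cut off to the unit interval. -/
theorem tendsto_fourierHat_cofinite (f : ℝ → ℝ) :
    Tendsto (fourierHat f) cofinite (𝓝 0) := by
  have h := (Real.tendsto_integral_exp_smul_cocompact
    ((Set.Icc (0 : ℝ) 1).indicator fun x => (f x : ℂ))).comp Int.tendsto_coe_cofinite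
  refine h.congr fun k => ?_
  rw [fourierHat, ← integral_indicator measurableSet_Icc, Function.comp]
  congr 1
  ext x
  by_cases hx : x ∈ Set.Icc (0 : ℝ) 1
  · rw [Set.indicator_of_mem hx, Set.indicator_of_mem hx, Circle.smul_def, Real.fourierChar_apply,
      smul_eq_mul, mul_comm]
    congr 2
    push_cast
    ring
  · rw [Set.indicator_of_notMem hx, Set.indicator_of_notMem hx, smul_zero]

theorem integral_exp_two_pi (k : ℤ) :
    ∫ x in (0 : ℝ)..1, Complex.exp (-2 * Real.pi * Complex.I * k * x) = if k = 0 then 1 else 0 := by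
  split_ifs with hk
  · simp [hk]
  · have hne : -2 * (Real.pi : ℂ) * Complex.I * k ≠ 0 := by
      simp [hk, Real.pi_ne_zero]
    rw [integral_exp_mul_complex hne]
    have : Complex.exp (-2 * Real.pi * Complex.I * k * (1 : ℝ)) = 1 := by
      rw [Complex.exp_eq_one_iff]
      exact ⟨-k, by push_cast; ring⟩
    rw [this]
    simp

/-- The symbol is the reciprocal, up to the factor `c`, of a trigonometric polynomial. -/
theorem fourierHat_symbol_recurrence {c d : ℝ} (hc : 0 < c) (hd : 0 ≤ d) (k : ℤ) :
    (c + 2 * d + 3) * fourierHat (symbol c d) k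
      + (d + 2) * (fourierHat (symbol c d) (k - 1) + fourierHat (symbol c d) (k + 1))
      + (fourierHat (symbol c d) (k - 2) + fourierHat (symbol c d) (k + 2))
      = if k = 0 then (c : ℂ) else 0 := by
  have hcont : ∀ k : ℤ, Continuous fun x : ℝ =>
      (symbol c d x : ℂ) * Complex.exp (-2 * Real.pi * Complex.I * k * x) := fun k =>
    (Complex.continuous_ofReal.comp (continuous_symbol hc hd)).mul (by fun_prop)
  have hint : ∀ k : ℤ, IntervalIntegrable (fun x : ℝ =>
      (symbol c d x : ℂ) * Complex.exp (-2 * Real.pi * Complex.I * k * x)) volume 0 1 := fun k =>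
    (hcont k).intervalIntegrable _ _
  simp only [fourierHat_eq_intervalIntegral]
  rw [← intervalIntegral.integral_add (hint _) (hint _),
    ← intervalIntegral.integral_add (hint _) (hint _),
    ← intervalIntegral.integral_const_mul, ← intervalIntegral.integral_const_mul,
    ← intervalIntegral.integral_add ((hint _).const_mul _) (((hint _).add (hint _)).const_mul _),
    ← intervalIntegral.integral_add
      (((hint _).const_mul _).add (((hint _).add (hint _)).const_mul _)) ((hint _).add (hint _))]
  have hR : (if k = 0 then (c : ℂ) else 0)
      = ∫ x in (0 : ℝ)..1, (c : ℂ) * Complex.exp (-2 * Real.pi * Complex.I * k * x) := by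
    rw [intervalIntegral.integral_const_mul, integral_exp_two_pi]
    simp
  rw [hR]
  congr 1
  ext x
  have hD := (hc.trans_le (le_symbol_denom (c := c) hd x)).ne'
  have hs : (symbol c d x : ℂ) * ((c + 2 * d + 3) + (d + 2) *
      (Complex.exp (2 * Real.pi * x * Complex.I) + Complex.exp (-(2 * Real.pi * x * Complex.I)))
      + (Complex.exp (4 * Real.pi * x * Complex.I) + Complex.exp (-(4 * Real.pi * x * Complex.I))))
      = c := by
    have h1 : Complex.exp (2 * Real.pi * x * Complex.I) + Complex.exp (-(2 * Real.pi * x * Complex.I))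
        = 2 * (Real.cos (2 * Real.pi * x) : ℂ) := by
      push_cast
      rw [Complex.two_cos, neg_mul]
    have h2 : Complex.exp (4 * Real.pi * x * Complex.I) + Complex.exp (-(4 * Real.pi * x * Complex.I))
        = 2 * (Real.cos (4 * Real.pi * x) : ℂ) := by
      push_cast
      rw [Complex.two_cos, neg_mul]
    rw [h1, h2]
    have h3 : symbol c d x * ((c + 2 * d + 3) + 2 * (d + 2) * Real.cos (2 * Real.pi * x)
      + 2 * Real.cos (4 * Real.pi * x)) = c := by
      rw [symbol, div_mul_cancel₀ _ hD]
    have h4 := congrArg (fun y : ℝ => (y : ℂ)) h3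
    push_cast at h4 ⊢
    linear_combination h4
  -- Shifting the index of a Fourier coefficient multiplies the integrand by a character; the five
  -- shifts together assemble the denominator of the symbol, which `hs` cancels.
  have hshift : ∀ j : ℤ, Complex.exp (-2 * Real.pi * Complex.I * ((k + j : ℤ) : ℂ) * x)
      = Complex.exp (-2 * Real.pi * Complex.I * k * x)
        * Complex.exp (-2 * Real.pi * Complex.I * j * x) := by
    intro j
    rw [← Complex.exp_add]
    congr 1
    push_cast
    ring
  have e1 := hshift (-1)
  have e2 := hshift 1
  have e3 := hshift (-2)
  have e4 := hshift 2
  rw [show -2 * (Real.pi : ℂ) * Complex.I * ((-1 : ℤ) : ℂ) * x = 2 * Real.pi * x * Complex.I by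
    push_cast; ring] at e1
  rw [show -2 * (Real.pi : ℂ) * Complex.I * ((1 : ℤ) : ℂ) * x = -(2 * Real.pi * x * Complex.I) by
    push_cast; ring] at e2
  rw [show -2 * (Real.pi : ℂ) * Complex.I * ((-2 : ℤ) : ℂ) * x = 4 * Real.pi * x * Complex.I by
    push_cast; ring] at e3
  rw [show -2 * (Real.pi : ℂ) * Complex.I * ((2 : ℤ) : ℂ) * x = -(4 * Real.pi * x * Complex.I) by
    push_cast; ring] at e4
  rw [← sub_eq_add_neg] at e1 e3
  simp only [e1, e2, e3, e4]
  linear_combination Complex.exp (-2 * Real.pi * Complex.I * k * x) * hs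

/-- The Green function of the infinite graph in the basis of the rungs. -/
def green (c d : ℝ) (k : ℤ) : ℝ := (fourierHat (symbol c d) k).re / c

theorem fourierHat_symbol_eq_green {c : ℝ} (hc : 0 < c) (d : ℝ) (k : ℤ) :
    fourierHat (symbol c d) k = ((c * green c d k : ℝ) : ℂ) := by
  rw [green, mul_div_cancel₀ _ hc.ne']
  exact Complex.ext rfl (by simp [fourierHat_symbol_im])

theorem green_neg (c d : ℝ) (k : ℤ) : green c d (-k) = green c d k := by
  rw [green, fourierHat_symbol_neg, green]

theorem tendsto_green (c d : ℝ) : Tendsto (green c d) cofinite (𝓝 0) := by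
  have h := (Complex.continuous_re.tendsto 0).comp (tendsto_fourierHat_cofinite (symbol c d))
  have h' := h.div_const c
  rw [Complex.zero_re, zero_div] at h'
  exact h'

theorem green_recurrence {c d : ℝ} (hc : 0 < c) (hd : 0 ≤ d) (k : ℤ) :
    (c + 2 * d + 3) * green c d k + (d + 2) * (green c d (k - 1) + green c d (k + 1))
      + (green c d (k - 2) + green c d (k + 2)) = if k = 0 then 1 else 0 := by
  have h := fourierHat_symbol_recurrence hc hd k
  simp only [fourierHat_symbol_eq_green hc] at h
  refine mul_left_cancel₀ hc.ne' ?_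
  have h' : c * ((c + 2 * d + 3) * green c d k
      + (d + 2) * (green c d (k - 1) + green c d (k + 1))
      + (green c d (k - 2) + green c d (k + 2))) = if k = 0 then c else 0 := by
    rw [← Complex.ofReal_inj]
    split_ifs at h ⊢ <;> push_cast at h ⊢ <;> linear_combination h
  rw [h']
  simp

/-! ### Comparison of the finite and infinite Green functions -/

theorem sum_rung_ite_mul {m n k : ℤ} (hk : k ∈ Finset.Ioc m n) (v : ℤ → ℝ) :
    ∑ j : Rung m n, (if (j : ℤ) = k then (1 : ℝ) else 0) * v j = v k := by
  rw [Finset.sum_coe_sort (Finset.Ioc m n) (fun j => (if j = k then (1 : ℝ) else 0) * v j)]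
  simp only [ite_mul, one_mul, zero_mul, Finset.sum_ite_eq', if_pos hk]

/-- Each conditional term is one `g` or `h` edge covering rung `i`, present when it lies inside the
subgraph. All are present unless `i` is one of the two first or two last rungs, so elsewhere the row
is that of the Toeplitz operator. -/
theorem laplacian_mulVec (c d : ℝ) {m n : ℤ} (v : ℤ → ℝ) (i : Rung m n) :
    (laplacian c d m n).mulVec (fun j => v j) i
      = c * v i + d * ((if m + 1 < (i : ℤ) then v i + v (i - 1) else 0)
          + (if (i : ℤ) + 1 ≤ n then v (i + 1) + v i else 0))
        + ((if m + 2 < (i : ℤ) then v i + v (i - 1) + v (i - 2) else 0)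
          + (if m + 1 < (i : ℤ) ∧ (i : ℤ) + 1 ≤ n then v (i + 1) + v i + v (i - 1) else 0)
          + (if (i : ℤ) + 2 ≤ n then v (i + 2) + v (i + 1) + v i else 0)) := by
  have hi := Finset.mem_Ioc.1 i.2
  have h1 : (laplacian c d m n).mulVec (fun j => v j) i = ∑ e ∈ finiteEdges m n,
      edgeWeight c d e * row m n e i * ∑ j, row m n e j * v j := by
    simp only [Matrix.mulVec, dotProduct, laplacian, Matrix.of_apply, Finset.sum_mul,
      Finset.mul_sum]
    rw [Finset.sum_comm]
    exact Finset.sum_congr rfl fun e _ => Finset.sum_congr rfl fun j _ => by ring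
  have hz : ∀ k ∈ Finset.Ioc m n, ∑ j, row m n (zEdge k) j * v j = v k := by
    intro k hk
    rw [← sum_rung_ite_mul hk v]
    exact Finset.sum_congr rfl fun j _ => by simp [row, bvec_zEdge]
  have hg : ∀ k ∈ Finset.Ioc (m + 1) n,
      ∑ j, row m n (gEdge k) j * v j = v k + v (k - 1) := by
    intro k hk
    rw [Finset.mem_Ioc] at hk
    rw [← sum_rung_ite_mul (m := m) (n := n) (k := k) (by rw [Finset.mem_Ioc]; lia) v,
      ← sum_rung_ite_mul (m := m) (n := n) (k := k - 1) (by rw [Finset.mem_Ioc]; lia) v,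
      ← Finset.sum_add_distrib]
    refine Finset.sum_congr rfl fun j _ => ?_
    rw [row, bvec_gEdge, ← add_mul]
    congr 1
    split_ifs <;> first | lia | norm_num
  have hh : ∀ k ∈ Finset.Ioc (m + 2) n,
      ∑ j, row m n (hEdge k) j * v j = v k + v (k - 1) + v (k - 2) := by
    intro k hk
    rw [Finset.mem_Ioc] at hk
    rw [← sum_rung_ite_mul (m := m) (n := n) (k := k) (by rw [Finset.mem_Ioc]; lia) v,
      ← sum_rung_ite_mul (m := m) (n := n) (k := k - 1) (by rw [Finset.mem_Ioc]; lia) v,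
      ← sum_rung_ite_mul (m := m) (n := n) (k := k - 2) (by rw [Finset.mem_Ioc]; lia) v,
      ← Finset.sum_add_distrib, ← Finset.sum_add_distrib]
    refine Finset.sum_congr rfl fun j _ => ?_
    rw [row, bvec_hEdge, ← add_mul, ← add_mul]
    congr 1
    split_ifs <;> first | lia | norm_num
  rw [h1, sum_finiteEdges]
  refine congrArg₂ (· + ·) (congrArg₂ (· + ·) ?_ ?_) ?_
  · rw [Finset.sum_congr rfl fun k hk => by rw [hz k hk]]
    simp only [edgeWeight_zEdge, row, bvec_zEdge, Int.cast_ite, Int.cast_one, Int.cast_zero,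
      mul_ite, mul_one, mul_zero, ite_mul, zero_mul, Finset.sum_ite_eq, if_pos i.2]
  · have : ∀ k ∈ Finset.Ioc (m + 1) n, edgeWeight c d (gEdge k) * row m n (gEdge k) i *
        ∑ j, row m n (gEdge k) j * v j
        = d * ((if (i : ℤ) = k then v k + v (k - 1) else 0)
          + (if (i : ℤ) + 1 = k then v k + v (k - 1) else 0)) := by
      intro k hk
      rw [hg k hk, edgeWeight_gEdge, row, bvec_gEdge]
      split_ifs <;> first | lia | (push_cast; ring1)
    rw [Finset.sum_congr rfl this, ← Finset.mul_sum, Finset.sum_add_distrib, Finset.sum_ite_eq,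
      Finset.sum_ite_eq]
    simp only [Finset.mem_Ioc, add_sub_cancel_right]
    congr 2
    · exact if_congr (by lia) rfl rfl
    · exact if_congr (by lia) rfl rfl
  · have : ∀ k ∈ Finset.Ioc (m + 2) n, edgeWeight c d (hEdge k) * row m n (hEdge k) i *
        ∑ j, row m n (hEdge k) j * v j
        = (if (i : ℤ) = k then v k + v (k - 1) + v (k - 2) else 0)
          + (if (i : ℤ) + 1 = k then v k + v (k - 1) + v (k - 2) else 0)
          + (if (i : ℤ) + 2 = k then v k + v (k - 1) + v (k - 2) else 0) := by
      intro k hk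
      rw [hh k hk, edgeWeight_hEdge, row, bvec_hEdge]
      split_ifs <;> first | lia | (push_cast; ring1)
    rw [Finset.sum_congr rfl this, Finset.sum_add_distrib, Finset.sum_add_distrib,
      Finset.sum_ite_eq, Finset.sum_ite_eq, Finset.sum_ite_eq]
    simp only [Finset.mem_Ioc]
    refine congrArg₂ (· + ·) (congrArg₂ (· + ·) ?_ ?_) ?_
    · exact if_congr (by lia) rfl rfl
    · refine if_congr (by lia) ?_ rfl
      rw [add_sub_cancel_right, show (i : ℤ) + 1 - 2 = i - 1 by ring]
    · refine if_congr (by lia) ?_ rfl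
      rw [add_sub_cancel_right, show (i : ℤ) + 2 - 1 = i + 1 by ring]

/-- Coercivity and Young's inequality give $c\|u\|^2\le\langle u,r\rangle\le\frac
c2\|u\|^2+\frac1{2c}\|r\|^2$. The residual lives on at most four rungs, so $\|r\|^2\le4B^2$ whatever
the length of the interval. -/
theorem abs_le_of_laplacian_mulVec {c d : ℝ} (hc : 0 < c) (hd : 0 ≤ d) {m n : ℤ} {B : ℝ}
    (hB : 0 ≤ B) (u r : Rung m n → ℝ) (hr : (laplacian c d m n).mulVec u = r)
    (hint : ∀ i : Rung m n, m + 2 < (i : ℤ) → (i : ℤ) + 2 ≤ n → r i = 0) (hbd : ∀ i, |r i| ≤ B)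
    (j : Rung m n) : |u j| ≤ 2 * B / c := by
  have h1 := le_dotProduct_laplacian_mulVec hc hd m n u
  rw [hr, dotProduct] at h1
  have h2 : ∑ i, u i * r i ≤ ∑ i, (c / 2 * u i ^ 2 + 1 / (2 * c) * r i ^ 2) := by
    refine Finset.sum_le_sum fun i _ => ?_
    have h := sq_nonneg (c * u i - r i)
    have h' : c / 2 * u i ^ 2 + 1 / (2 * c) * r i ^ 2 - u i * r i
        = 1 / (2 * c) * (c * u i - r i) ^ 2 := by
      field_simp
      ring
    have := mul_nonneg (by positivity : 0 ≤ 1 / (2 * c)) h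
    linarith
  rw [Finset.sum_add_distrib, ← Finset.mul_sum, ← Finset.mul_sum] at h2
  have h3 : ∑ i, r i ^ 2 ≤ 4 * B ^ 2 := by
    have hle : ∀ i : Rung m n, r i ^ 2 ≤ B ^ 2 * ((if (i : ℤ) = m + 1 then 1 else 0)
        + (if (i : ℤ) = m + 2 then 1 else 0) + (if (i : ℤ) = n - 1 then 1 else 0)
        + (if (i : ℤ) = n then 1 else 0)) := by
      intro i
      have hi := Finset.mem_Ioc.1 i.2
      by_cases hin : m + 2 < (i : ℤ) ∧ (i : ℤ) + 2 ≤ n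
      · rw [hint i hin.1 hin.2, zero_pow two_ne_zero]
        positivity
      · have hB2 : r i ^ 2 ≤ B ^ 2 := sq_le_sq' (abs_le.1 (hbd i)).1 (abs_le.1 (hbd i)).2
        refine hB2.trans (le_mul_of_one_le_right (sq_nonneg B) ?_)
        split_ifs <;> first | lia | norm_num
    have hone : ∀ k : ℤ, ∑ i : Rung m n, (if (i : ℤ) = k then (1 : ℝ) else 0) ≤ 1 := by
      intro k
      rw [Finset.sum_coe_sort (Finset.Ioc m n) (fun i => if i = k then (1 : ℝ) else 0),
        Finset.sum_ite_eq']
      split_ifs <;> norm_num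
    refine (Finset.sum_le_sum fun i _ => hle i).trans ?_
    rw [← Finset.mul_sum, Finset.sum_add_distrib, Finset.sum_add_distrib, Finset.sum_add_distrib,
      mul_comm]
    refine mul_le_mul_of_nonneg_right ?_ (sq_nonneg B)
    linarith [hone (m + 1), hone (m + 2), hone (n - 1), hone n]
  have h4 : u j ^ 2 ≤ ∑ i, u i ^ 2 :=
    Finset.single_le_sum (f := fun i => u i ^ 2) (fun i _ => sq_nonneg (u i)) (Finset.mem_univ j)
  have h5 : c / 2 * u j ^ 2 ≤ 1 / (2 * c) * (4 * B ^ 2) := by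
    have := mul_le_mul_of_nonneg_left h4 (by positivity : 0 ≤ c / 2)
    have := mul_le_mul_of_nonneg_left h3 (by positivity : 0 ≤ 1 / (2 * c))
    linarith
  refine abs_le_of_sq_le_sq ?_ (by positivity)
  have h6 : (2 * B / c) ^ 2 = 2 / c * (1 / (2 * c) * (4 * B ^ 2)) := by
    field_simp
    ring
  rw [h6]
  calc u j ^ 2 = 2 / c * (c / 2 * u j ^ 2) := by field_simp
    _ ≤ _ := mul_le_mul_of_nonneg_left h5 (by positivity)

/-- The difference of the two Green columns has a residual only at boundary rungs, equal to the
terms of the missing edges: two of size $2M$ with weight $d$ and three of size $3M$, whence $4d+9$.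
These terms reach at most two places from a boundary rung, which explains `m + 4` and `n - 3`. -/
theorem abs_green_sub_inv_laplacian_le {c d : ℝ} (hc : 0 < c) (hd : 0 ≤ d) {m n : ℤ} {M : ℝ}
    (j l : Rung m n)
    (hM : ∀ k : ℤ, k ≤ m + 4 ∨ n - 3 ≤ k → |green c d (k - l)| ≤ M) :
    |green c d (j - l) - (laplacian c d m n)⁻¹ j l| ≤ 2 * ((4 * d + 9) * M) / c := by
  have hM0 : 0 ≤ M := (abs_nonneg _).trans (hM m (by lia))
  set v : ℤ → ℝ := fun k => green c d (k - l) with hv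
  have hL : IsUnit (laplacian c d m n).det := (det_laplacian_ne_zero hc hd m n).isUnit
  have hrec : ∀ k : ℤ, (c + 2 * d + 3) * v k + (d + 2) * (v (k - 1) + v (k + 1))
      + (v (k - 2) + v (k + 2)) = if k = l then 1 else 0 := by
    intro k
    have h := green_recurrence hc hd (k - l)
    simp only [sub_eq_zero] at h
    rw [← h]
    simp only [hv, sub_right_comm, sub_add_eq_add_sub]
  refine abs_le_of_laplacian_mulVec hc hd (by positivity)
    (fun i => v i - (laplacian c d m n)⁻¹ i l)
    (fun i => (laplacian c d m n).mulVec (fun j => v j) i - if (i : ℤ) = l then 1 else 0) ?_ ?_ ?_ j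
  · have : (fun i : Rung m n => v i - (laplacian c d m n)⁻¹ i l)
        = (fun i : Rung m n => v i) - fun i => (laplacian c d m n)⁻¹ i l := rfl
    rw [this, Matrix.mulVec_sub]
    ext i
    rw [Pi.sub_apply]
    congr 1
    have h := congrFun (congrFun (Matrix.mul_nonsing_inv _ hL) i) l
    rw [Matrix.mul_apply, Matrix.one_apply] at h
    simp only [Matrix.mulVec, dotProduct, h, Subtype.ext_iff]
  · intro i h1 h2
    rw [laplacian_mulVec, if_pos (by lia), if_pos (by lia), if_pos (by lia), if_pos (by lia),
      if_pos (by lia), ← hrec i]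
    ring
  · intro i
    by_cases hin : m + 2 < (i : ℤ) ∧ (i : ℤ) + 2 ≤ n
    · rw [laplacian_mulVec, if_pos (by lia), if_pos (by lia), if_pos (by lia), if_pos (by lia),
        if_pos (by lia), ← hrec i]
      have : (4 * d + 9) * M ≥ 0 := by positivity
      ring_nf
      simpa [mul_comm] using by linarith
    · have hi := Finset.mem_Ioc.1 i.2
      have b0 := abs_le.1 (hM i (by lia))
      have b1 := abs_le.1 (hM (i + 1) (by lia))
      have b2 := abs_le.1 (hM (i + 2) (by lia))
      have b3 := abs_le.1 (hM (i - 1) (by lia))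
      have b4 := abs_le.1 (hM (i - 2) (by lia))
      -- Subtracting the full recurrence turns every conditional into its complement: only the edges
      -- that leave the subgraph remain.
      have key : (laplacian c d m n).mulVec (fun j => v j) i - (if (i : ℤ) = l then 1 else 0)
          = -(d * ((if m + 1 < (i : ℤ) then 0 else v i + v (i - 1))
          + (if (i : ℤ) + 1 ≤ n then 0 else v (i + 1) + v i))
        + ((if m + 2 < (i : ℤ) then 0 else v i + v (i - 1) + v (i - 2))
          + (if m + 1 < (i : ℤ) ∧ (i : ℤ) + 1 ≤ n then 0 else v (i + 1) + v i + v (i - 1))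
          + (if (i : ℤ) + 2 ≤ n then 0 else v (i + 2) + v (i + 1) + v i))) := by
        rw [laplacian_mulVec, ← hrec i]
        have hsplit : ∀ (p : Prop) [Decidable p] (x : ℝ),
            (if p then x else 0) = x - if p then 0 else x := by
          intro p _ x
          split_ifs <;> ring
        simp only [hsplit _ (v _ + v _), hsplit _ (v _ + v _ + v _)]
        ring
      have hbound : ∀ (p : Prop) [Decidable p] (x y : ℝ), |x| ≤ y → |if p then 0 else x| ≤ y := by
        intro p _ x y h
        split_ifs
        · simpa using (abs_nonneg x).trans h
        · exact h
      have c1 := abs_le.1 (hbound (m + 1 < (i : ℤ)) (v i + v (i - 1)) (2 * M)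
        (abs_le.2 ⟨by linarith, by linarith⟩))
      have c2 := abs_le.1 (hbound ((i : ℤ) + 1 ≤ n) (v (i + 1) + v i) (2 * M)
        (abs_le.2 ⟨by linarith, by linarith⟩))
      have c3 := abs_le.1 (hbound (m + 2 < (i : ℤ)) (v i + v (i - 1) + v (i - 2)) (3 * M)
        (abs_le.2 ⟨by linarith, by linarith⟩))
      have c4 := abs_le.1 (hbound (m + 1 < (i : ℤ) ∧ (i : ℤ) + 1 ≤ n)
        (v (i + 1) + v i + v (i - 1)) (3 * M) (abs_le.2 ⟨by linarith, by linarith⟩))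
      have c5 := abs_le.1 (hbound ((i : ℤ) + 2 ≤ n) (v (i + 2) + v (i + 1) + v i) (3 * M)
        (abs_le.2 ⟨by linarith, by linarith⟩))
      rw [key, abs_neg]
      generalize (if m + 1 < (i : ℤ) then 0 else v i + v (i - 1)) = x1 at *
      generalize (if (i : ℤ) + 1 ≤ n then 0 else v (i + 1) + v i) = x2 at *
      refine (abs_add_le _ _).trans ?_
      have hx : |d * (x1 + x2)| ≤ d * (4 * M) := by
        rw [abs_mul, abs_of_nonneg hd]
        exact mul_le_mul_of_nonneg_left (abs_le.2 ⟨by linarith, by linarith⟩) hd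
      have hy : |(if m + 2 < (i : ℤ) then 0 else v i + v (i - 1) + v (i - 2))
          + (if m + 1 < (i : ℤ) ∧ (i : ℤ) + 1 ≤ n then 0 else v (i + 1) + v i + v (i - 1))
          + (if (i : ℤ) + 2 ≤ n then 0 else v (i + 2) + v (i + 1) + v i)| ≤ 9 * M :=
        abs_le.2 ⟨by linarith, by linarith⟩
      linarith

open Classical in
/-- The Green function of the subgraph induced on `{m, …, n}`, extended by zero. -/
def localGreen (c d : ℝ) (m n k l : ℤ) : ℝ :=
  if h : k ∈ Finset.Ioc m n ∧ l ∈ Finset.Ioc m n then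
    (laplacian c d m n)⁻¹ ⟨k, h.1⟩ ⟨l, h.2⟩ else 0

theorem tendsto_localGreen {c d : ℝ} (hc : 0 < c) (hd : 0 ≤ d) (k l : ℤ) :
    Tendsto (fun n : ℕ => localGreen c d (-n) n k l) atTop (𝓝 (green c d (k - l))) := by
  rw [Metric.tendsto_atTop]
  intro δ hδ
  -- This choice makes the comparison bound equal to `δ / 2`.
  set M := δ * c / (4 * (4 * d + 9)) with hMdef
  have hM : 0 < M := by positivity
  have hev : ∀ᶠ j : ℤ in cofinite, |green c d j| ≤ M := by
    have := (Metric.tendsto_nhds.1 (tendsto_green c d)) M hM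
    filter_upwards [this] with j hj
    rw [Real.dist_eq, sub_zero] at hj
    exact hj.le
  rw [Filter.eventually_cofinite] at hev
  obtain ⟨R, hR⟩ : ∃ R : ℕ, ∀ j : ℤ, (R : ℤ) ≤ |j| → |green c d j| ≤ M := by
    obtain ⟨R, hR⟩ := (hev.image Int.natAbs).bddAbove
    refine ⟨R + 1, fun j hj => ?_⟩
    by_contra h
    have := hR ⟨j, h, rfl⟩
    rw [Int.abs_eq_natAbs] at hj
    lia
  refine ⟨R + 4 + k.natAbs + l.natAbs + 1, fun n hn => ?_⟩
  have hk : k ∈ Finset.Ioc (-n : ℤ) n := by rw [Finset.mem_Ioc]; lia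
  have hl : l ∈ Finset.Ioc (-n : ℤ) n := by rw [Finset.mem_Ioc]; lia
  rw [localGreen, dif_pos ⟨hk, hl⟩, dist_comm, Real.dist_eq]
  refine (abs_green_sub_inv_laplacian_le hc hd (M := M) (⟨k, hk⟩ : Rung (-n) n) ⟨l, hl⟩ ?_).trans_lt ?_
  · intro j hj
    refine hR _ ?_
    simp only
    rcases abs_cases (j - l) with h | h <;> lia
  · rw [hMdef]
    have : 2 * ((4 * d + 9) * (δ * c / (4 * (4 * d + 9)))) / c = δ / 2 := by
      field_simp
      ring
    rw [this]
    linarith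

/-! ### Convergence of transfer currents and of window probabilities -/

/-- The transfer-current matrix of the infinite graph. -/
def transferLim (c d : ℝ) (e f : Sym2 ℤ) : ℝ :=
  edgeWeight c d e * ∑ k ∈ Finset.Ioc e.inf e.sup, ∑ l ∈ Finset.Ioc f.inf f.sup,
    bvec e k * green c d (k - l) * bvec f l

theorem bvec_eq_zero {e : Sym2 ℤ} {k : ℤ} (h : k ∉ Finset.Ioc e.inf e.sup) : bvec e k = 0 := by
  have := e.inf_le_sup
  rw [Finset.mem_Ioc] at h
  rw [bvec, heaviside, heaviside]
  split_ifs <;> lia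

theorem transfer_eq_sum_localGreen (c d : ℝ) {m n : ℤ} {e f : Sym2 ℤ}
    (he : Finset.Ioc e.inf e.sup ⊆ Finset.Ioc m n) (hf : Finset.Ioc f.inf f.sup ⊆ Finset.Ioc m n) :
    transfer c d m n e f = localWeight c d m n e *
      ∑ k ∈ Finset.Ioc e.inf e.sup, ∑ l ∈ Finset.Ioc f.inf f.sup,
        bvec e k * localGreen c d m n k l * bvec f l := by
  have h1 : ∀ k, ∑ l ∈ Finset.Ioc f.inf f.sup, bvec e k * localGreen c d m n k l * bvec f l
      = ∑ l ∈ Finset.Ioc m n, bvec e k * localGreen c d m n k l * bvec f l := fun k =>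
    Finset.sum_subset hf fun l _ hl => by rw [bvec_eq_zero hl]; simp
  rw [transfer, Finset.sum_congr rfl fun k _ => h1 k,
    Finset.sum_subset he fun k _ hk => by simp [bvec_eq_zero hk],
    ← Finset.sum_coe_sort (Finset.Ioc m n)]
  congr 1
  refine Finset.sum_congr rfl fun i _ => ?_
  rw [← Finset.sum_coe_sort (Finset.Ioc m n)]
  refine Finset.sum_congr rfl fun j _ => ?_
  rw [localGreen, dif_pos ⟨i.2, j.2⟩]
  rfl

theorem tendsto_transfer {c d : ℝ} (hc : 0 < c) (hd : 0 ≤ d) (e f : Sym2 ℤ) :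
    Tendsto (fun n : ℕ => transfer c d (-n) n e f) atTop (𝓝 (transferLim c d e f)) := by
  have hbig : ∀ a : ℤ, ∀ᶠ n : ℕ in atTop, (-n : ℤ) ≤ a ∧ a ≤ n := by
    intro a
    filter_upwards [eventually_ge_atTop a.natAbs] with n hn
    lia
  have hw : ∀ᶠ n : ℕ in atTop, localWeight c d (-n) n e = edgeWeight c d e := by
    by_cases hE : e ∈ edges
    · induction e with | _ a b =>
      filter_upwards [hbig a, hbig b] with n ha hb
      rw [localWeight, if_pos]
      rw [mem_finiteEdges]
      refine ⟨?_, hE⟩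
      simp only [Sym2.mem_iff, forall_eq_or_imp, forall_eq, Set.mem_Icc]
      exact ⟨ha, hb⟩
    · refine Eventually.of_forall fun n => ?_
      rw [localWeight, edgeWeight_of_notMem c d hE, ite_self]
  have hsub : ∀ e : Sym2 ℤ, ∀ᶠ n : ℕ in atTop,
      Finset.Ioc e.inf e.sup ⊆ Finset.Ioc (-n : ℤ) n := by
    intro e
    filter_upwards [hbig e.inf, hbig e.sup] with n h1 h2
    exact Finset.Ioc_subset_Ioc h1.1 h2.2
  have hlim : Tendsto (fun n : ℕ => edgeWeight c d e *
      ∑ k ∈ Finset.Ioc e.inf e.sup, ∑ l ∈ Finset.Ioc f.inf f.sup,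
        bvec e k * localGreen c d (-n) n k l * bvec f l) atTop (𝓝 (transferLim c d e f)) :=
    tendsto_const_nhds.mul (tendsto_finsetSum _ fun k _ => tendsto_finsetSum _ fun l _ =>
      (tendsto_const_nhds.mul (tendsto_localGreen hc hd k l)).mul tendsto_const_nhds)
  refine hlim.congr' ?_
  filter_upwards [hw, hsub e, hsub f] with n h1 h2 h3
  rw [transfer_eq_sum_localGreen c d h2 h3, h1]

theorem transferLim_zEdge (c d : ℝ) (k l : ℤ) :
    transferLim c d (zEdge k) (zEdge l) = c * green c d (k - l) := by
  have h1 : ∀ k : ℤ, Finset.Ioc (zEdge k).inf (zEdge k).sup = {k} := by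
    intro k
    have h1 : (zEdge k).sup = k := sup_eq_right.2 (by lia)
    have h2 : (zEdge k).inf = k - 1 := inf_eq_left.2 (by lia)
    ext j
    rw [h1, h2, Finset.mem_Ioc, Finset.mem_singleton]
    lia
  simp [transferLim, h1, edgeWeight_zEdge, bvec_zEdge]

open Classical in
theorem tendsto_finiteProb {c d : ℝ} (hc : 0 < c) (hd : 0 ≤ d)
    {κ : Type*} [Fintype κ] [DecidableEq κ] (ε : κ → Sym2 ℤ) (hε : Function.Injective ε)
    (B : Set (Sym2 ℤ)) :
    Tendsto (fun n : ℕ => finiteProb c d n {T | ∀ i, ε i ∈ T ↔ ε i ∈ B}) atTop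
      (𝓝 (Matrix.diagonal (fun i => if ε i ∈ B then (0 : ℝ) else 1)
        + Matrix.diagonal (fun i => if ε i ∈ B then (1 : ℝ) else -1) *
        Matrix.of fun i j => transferLim c d (ε i) (ε j)).det) := by
  simp only [finiteProb_eq_det hc hd _ ε hε B]
  have hcont : Continuous fun Y : Matrix κ κ ℝ =>
      (Matrix.diagonal (fun i => if ε i ∈ B then (0 : ℝ) else 1)
        + Matrix.diagonal (fun i => if ε i ∈ B then (1 : ℝ) else -1) * Y).det :=
    (continuous_const.add (continuous_const.mul continuous_id)).matrix_det
  refine (hcont.tendsto _).comp ?_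
  exact tendsto_pi_nhds.2 fun i => tendsto_pi_nhds.2 fun j => tendsto_transfer hc hd _ _

/-! ### Existence and uniqueness of the limit measure -/

theorem windowEvent_eq (K : Finset (Sym2 ℤ)) (B : Set (Sym2 ℤ)) :
    windowEvent K B = {T | ∀ i : K, (i : Sym2 ℤ) ∈ T ↔ (i : Sym2 ℤ) ∈ B} := by
  ext T
  exact ⟨fun h i => h i i.2, fun h e he => h ⟨e, he⟩⟩

theorem measurableSet_mem (e : Sym2 ℤ) : MeasurableSet {T : Set (Sym2 ℤ) | e ∈ T} :=
  measurableSet_setOfPred.2 (measurable_set_mem e)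

theorem measurableSet_windowEvent (K : Finset (Sym2 ℤ)) (B : Set (Sym2 ℤ)) :
    MeasurableSet (windowEvent K B) := by
  have : windowEvent K B = ⋂ e ∈ K, {T | e ∈ T ↔ e ∈ B} := by
    ext T
    simp [windowEvent]
  rw [this]
  refine K.measurableSet_biInter fun e _ => ?_
  by_cases he : e ∈ B
  · simpa [he] using measurableSet_mem e
  · simp only [he, iff_false]
    exact (measurableSet_mem e).compl

theorem generateFrom_windowEvent :
    (inferInstance : MeasurableSpace (Set (Sym2 ℤ)))
      = MeasurableSpace.generateFrom {W | ∃ K B, W = windowEvent K B} := by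
  refine le_antisymm ?_ ?_
  · have h : @Measurable _ _ (MeasurableSpace.generateFrom {W | ∃ K B, W = windowEvent K B}) _
        (id : Set (Sym2 ℤ) → Set (Sym2 ℤ)) := by
      refine (@measurable_set_iff _ _ (_) _).2 fun e => ?_
      refine (@measurableSet_setOfPred _ (_) _).1 (MeasurableSpace.measurableSet_generateFrom ?_)
      exact ⟨{e}, Set.univ, by ext T; simp [windowEvent]⟩
    exact fun s hs => h hs
  · refine MeasurableSpace.generateFrom_le ?_
    rintro _ ⟨K, B, rfl⟩
    exact measurableSet_windowEvent K B

theorem isPiSystem_windowEvent : IsPiSystem {W | ∃ K B, W = windowEvent K B} := by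
  classical
  rintro _ ⟨K, B, rfl⟩ _ ⟨K', B', rfl⟩ ⟨T, hT, hT'⟩
  -- A common point `T` of the two windows prescribes the pattern on the union. Empty intersections
  -- are exempt in a π-system.
  refine ⟨K ∪ K', T, ?_⟩
  ext U
  constructor
  · rintro ⟨h, h'⟩ e he
    rcases Finset.mem_union.1 he with he | he
    · rw [h e he, hT e he]
    · rw [h' e he, hT' e he]
  · intro h
    exact ⟨fun e he => by rw [h e (Finset.mem_union_left _ he), hT e he],
      fun e he => by rw [h e (Finset.mem_union_right _ he), hT' e he]⟩

theorem IsSpanningTreeMeasure.unique {c d : ℝ} {P Q : Measure (Set (Sym2 ℤ))}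
    (hP : IsSpanningTreeMeasure c d P) (hQ : IsSpanningTreeMeasure c d Q) : P = Q := by
  have := hP.isProbabilityMeasure
  have := hQ.isProbabilityMeasure
  refine ext_of_generate_finite _ generateFrom_windowEvent isPiSystem_windowEvent ?_ (by simp)
  rintro _ ⟨K, B, rfl⟩
  have h := tendsto_nhds_unique (hP.tendsto K B) (hQ.tendsto K B)
  rwa [measureReal_def, measureReal_def, ENNReal.toReal_eq_toReal_iff' (measure_ne_top _ _)
    (measure_ne_top _ _)] at h

theorem treeWeight_nonneg {c d : ℝ} (hc : 0 < c) (hd : 0 ≤ d) (t : Finset (Sym2 ℤ)) :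
    0 ≤ treeWeight c d t :=
  Finset.prod_nonneg fun e _ => edgeWeight_nonneg hc hd e

theorem sum_treeWeight_pos {c d : ℝ} (hc : 0 < c) (hd : 0 ≤ d) (n : ℕ) :
    0 < ∑ t ∈ spanningTrees (-n) n, treeWeight c d t := by
  refine lt_of_le_of_ne ?_ ?_
  · exact Finset.sum_nonneg fun t _ => treeWeight_nonneg hc hd t
  · have h := det_laplacian_ne_zero hc hd (-n) n
    rw [laplacian, det_eq_sum_spanningTrees (by lia)] at h
    exact h.symm

open Classical in
/-- The indicator function of a set of edges. -/
def indicatorBool (T : Set (Sym2 ℤ)) : Sym2 ℤ → Bool := fun e => decide (e ∈ T)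

/-- The set of edges with a given indicator function. -/
def support (x : Sym2 ℤ → Bool) : Set (Sym2 ℤ) := {e | x e = true}

theorem support_indicatorBool (T : Set (Sym2 ℤ)) : support (indicatorBool T) = T := by
  ext e
  simp [support, indicatorBool]

theorem measurable_support : Measurable support := by
  refine measurable_set_iff.2 fun e => measurableSet_setOfPred.1 ?_
  exact (measurable_pi_apply (X := fun _ : Sym2 ℤ => Bool) e) (measurableSet_singleton true)

theorem isClopen_preimage_windowEvent (K : Finset (Sym2 ℤ)) (B : Set (Sym2 ℤ)) :
    IsClopen (support ⁻¹' windowEvent K B) := by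
  have : support ⁻¹' windowEvent K B
      = ⋂ e ∈ K, (fun x : Sym2 ℤ → Bool => x e) ⁻¹' {b | b = true ↔ e ∈ B} := by
    ext x
    simp [windowEvent, support]
  rw [this]
  exact K.finite_toSet.isClopen_biInter fun e _ =>
    (isClopen_discrete _).preimage (continuous_apply e)

/-- The law of the weighted spanning tree of the subgraph induced on `{-n, …, n}`, on indicator
functions. -/
def finiteMeasure (c d : ℝ) (n : ℕ) : Measure (Sym2 ℤ → Bool) :=
  ∑ t ∈ spanningTrees (-n) n,
    ENNReal.ofReal (treeWeight c d t / ∑ t ∈ spanningTrees (-n) n, treeWeight c d t) •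
      Measure.dirac (indicatorBool t)

theorem finiteMeasure_apply {c d : ℝ} (hc : 0 < c) (hd : 0 ≤ d) (n : ℕ)
    {F : Set (Set (Sym2 ℤ))} (hF : MeasurableSet F) :
    finiteMeasure c d n (support ⁻¹' F) = ENNReal.ofReal (finiteProb c d n F) := by
  classical
  rw [finiteMeasure, finiteProb, Measure.finsetSum_apply, Finset.sum_div, Finset.sum_filter,
    ENNReal.ofReal_sum_of_nonneg]
  · refine Finset.sum_congr rfl fun t _ => ?_
    rw [Measure.smul_apply, Measure.dirac_apply' _ (measurable_support hF), smul_eq_mul]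
    by_cases ht : (t : Set (Sym2 ℤ)) ∈ F
    · rw [Set.indicator_of_mem (by simpa [support_indicatorBool] using ht), if_pos ht]
      simp
    · rw [Set.indicator_of_notMem (by simpa [support_indicatorBool] using ht), if_neg ht]
      simp
  · intro t _
    split_ifs
    · exact div_nonneg (treeWeight_nonneg hc hd t) (sum_treeWeight_pos hc hd n).le
    · exact le_rfl

theorem finiteProb_nonneg {c d : ℝ} (hc : 0 < c) (hd : 0 ≤ d) (n : ℕ) (F : Set (Set (Sym2 ℤ))) :
    0 ≤ finiteProb c d n F :=
  div_nonneg (Finset.sum_nonneg fun t _ => treeWeight_nonneg hc hd t)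
    (sum_treeWeight_pos hc hd n).le

theorem isProbabilityMeasure_finiteMeasure {c d : ℝ} (hc : 0 < c) (hd : 0 ≤ d) (n : ℕ) :
    IsProbabilityMeasure (finiteMeasure c d n) := by
  constructor
  have h := finiteMeasure_apply hc hd n (F := Set.univ) MeasurableSet.univ
  rw [Set.preimage_univ] at h
  rw [h, finiteProb]
  simp [div_self (sum_treeWeight_pos hc hd n).ne']

-- Probability measures on the compact space of indicator functions are compact, so an ultrafilter
-- limit exists. Window events are clopen, so their probabilities pass to this limit; as these
-- probabilities converge along the full sequence, the ultrafilter limit is the ordinary one.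
open Classical in
theorem exists_isSpanningTreeMeasure {c d : ℝ} (hc : 0 < c) (hd : 0 ≤ d) :
    ∃ P : Measure (Set (Sym2 ℤ)), IsSpanningTreeMeasure c d P := by
  let μ : ℕ → ProbabilityMeasure (Sym2 ℤ → Bool) := fun n =>
    ⟨finiteMeasure c d n, isProbabilityMeasure_finiteMeasure hc hd n⟩
  obtain ⟨ν, -, hν⟩ := isCompact_univ.ultrafilter_le_nhds ((hyperfilter ℕ).map μ) (by simp)
  have hν' : Tendsto μ (hyperfilter ℕ) (𝓝 ν) := hν
  refine ⟨(ν : Measure (Sym2 ℤ → Bool)).map support,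
    Measure.isProbabilityMeasure_map measurable_support.aemeasurable, fun K B => ?_⟩
  have h1 := ProbabilityMeasure.tendsto_measure_of_null_frontier_of_tendsto' hν'
    (E := support ⁻¹' windowEvent K B) (by
      rw [(isClopen_preimage_windowEvent K B).frontier_eq, measure_empty])
  have h2 := (ENNReal.tendsto_toReal (measure_ne_top _ _)).comp h1
  have h3 := tendsto_finiteProb hc hd (fun i : K => (i : Sym2 ℤ)) Subtype.val_injective B
  rw [← windowEvent_eq] at h3
  have h4 : Tendsto (fun n => finiteProb c d n (windowEvent K B)) (hyperfilter ℕ)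
      (𝓝 (((ν : Measure (Sym2 ℤ → Bool)) (support ⁻¹' windowEvent K B)).toReal)) := by
    refine h2.congr fun n => ?_
    change (finiteMeasure c d n (support ⁻¹' windowEvent K B)).toReal = _
    rw [finiteMeasure_apply hc hd n (measurableSet_windowEvent K B),
      ENNReal.toReal_ofReal (finiteProb_nonneg hc hd n _)]
  have h5 := tendsto_nhds_unique h4 (h3.mono_left Nat.hyperfilter_le_atTop)
  rw [measureReal_def, Measure.map_apply measurable_support (measurableSet_windowEvent K B), h5]
  exact h3

/-! ### The rung process is determinantal -/

theorem kernel_eq {c : ℝ} (hc : 0 < c) (d : ℝ) (k l : ℤ) :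
    kernel c d k l = ((c * green c d (k - l) : ℝ) : ℂ) := by
  rw [kernel, Matrix.of_apply, fourierHat_symbol_eq_green hc, ← green_neg, neg_sub]

theorem kernel_symm {c : ℝ} (hc : 0 < c) (d : ℝ) (k l : ℤ) : kernel c d k l = kernel c d l k := by
  rw [kernel_eq hc, kernel_eq hc, ← green_neg, neg_sub]

/-- The event that all rungs of `S` are present is a window event with pattern `Set.univ`. There the
limiting determinant loses its diagonal correction and is that of the transfer currents between
rungs. -/
theorem isDeterminantal_rungProcess {c d : ℝ} (hc : 0 < c) (hd : 0 ≤ d)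
    {P : Measure (Set (Sym2 ℤ))} (hP : IsSpanningTreeMeasure c d P) :
    IsDeterminantal P rungProcess (kernel c d) where
  isProbabilityMeasure := hP.isProbabilityMeasure
  measurable s := Measurable.ite (measurableSet_mem _) measurable_const measurable_const
  isHermitian := by
    ext k l
    rw [Matrix.conjTranspose_apply, kernel_symm hc d l k, kernel_eq hc]
    exact Complex.conj_ofReal _
  prob_eq_det S := by
    classical
    have hS : {T | ∀ s ∈ S, rungProcess s T = 1} = windowEvent (S.image zEdge) Set.univ := by
      ext T
      simp [windowEvent, rungProcess]
    have hS' : windowEvent (S.image zEdge) Set.univ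
        = {T | ∀ i : S, zEdge i ∈ T ↔ zEdge i ∈ (Set.univ : Set (Sym2 ℤ))} := by
      ext T
      simp [windowEvent]
    have h := tendsto_nhds_unique (hS' ▸ hP.tendsto (S.image zEdge) Set.univ)
      (tendsto_finiteProb hc hd (fun i : S => zEdge i)
        (zEdge_injective.comp Subtype.val_injective) Set.univ)
    rw [hS, hS', h, ← Complex.ofRealHom_eq_coe, RingHom.map_det]
    congr 1
    ext i j
    simp [transferLim_zEdge, kernel_eq hc]

/-! ### Decaying solutions of the recurrence -/

theorem tendsto_comp_add {a : ℤ → ℂ} (ha : Tendsto a cofinite (𝓝 0)) (j : ℤ) :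
    Tendsto (fun k => a (k + j)) cofinite (𝓝 0) :=
  ha.comp (add_left_injective j).tendsto_cofinite

/-- If `‖r‖ ≤ 1` the norms do not decrease when going left, and if `‖r‖ ≥ 1` when going right. In
either direction they tend to 0. -/
theorem eq_zero_of_geometric {a : ℤ → ℂ} (ha : Tendsto a cofinite (𝓝 0)) (r : ℂ)
    (h : ∀ k, a (k + 1) = r * a k) : a = 0 := by
  funext k
  rw [Pi.zero_apply, ← norm_le_zero_iff]
  rcases le_total ‖r‖ 1 with hr | hr
  · have hlim : Tendsto (fun n : ℕ => ‖a (k - n)‖) atTop (𝓝 0) := by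
      rw [← Nat.cofinite_eq_atTop]
      simpa using (ha.comp (Function.Injective.tendsto_cofinite
        (f := fun n : ℕ => k - (n : ℤ)) fun x y hxy => by simpa using hxy)).norm
    refine ge_of_tendsto' hlim fun n => ?_
    induction n with
    | zero => simp
    | succ n ih =>
      refine ih.trans ?_
      have := h (k - (n + 1 : ℕ))
      rw [show k - ((n + 1 : ℕ) : ℤ) + 1 = k - n by push_cast; ring] at this
      rw [this, norm_mul]
      exact mul_le_of_le_one_left (norm_nonneg _) hr
  · have hlim : Tendsto (fun n : ℕ => ‖a (k + n)‖) atTop (𝓝 0) := by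
      rw [← Nat.cofinite_eq_atTop]
      simpa using (ha.comp (Function.Injective.tendsto_cofinite
        (f := fun n : ℕ => k + (n : ℤ)) fun x y hxy => by simpa using hxy)).norm
    refine ge_of_tendsto' hlim fun n => ?_
    induction n with
    | zero => simp
    | succ n ih =>
      refine ih.trans ?_
      rw [show k + ((n + 1 : ℕ) : ℤ) = k + n + 1 by push_cast; ring, h, norm_mul]
      exact le_mul_of_one_le_left (norm_nonneg _) hr

/-- With $E$ the shift, $E^2-yE+1=(E-(y-r))(E-r)$, so the geometric case applies twice. The size of
`r` plays no role. -/
theorem eq_zero_of_quadratic {a : ℤ → ℂ} (ha : Tendsto a cofinite (𝓝 0)) {r y : ℂ}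
    (hr : r ^ 2 - y * r + 1 = 0) (h : ∀ k, a (k + 2) - y * a (k + 1) + a k = 0) : a = 0 := by
  have hb : (fun k => a (k + 1) - r * a k) = 0 := by
    refine eq_zero_of_geometric (r := y - r) ?_ fun k => ?_
    · simpa using (tendsto_comp_add ha 1).sub (ha.const_mul r)
    · rw [show k + 1 + 1 = k + 2 by ring]
      linear_combination h k - a k * hr
  exact eq_zero_of_geometric ha r fun k => sub_eq_zero.1 (congrFun hb k)

/-- After a shift by two, the operator is $(E^2-y_1E+1)(E^2-y_2E+1)$. -/
theorem eq_zero_of_quartic {a : ℤ → ℂ} (ha : Tendsto a cofinite (𝓝 0)) {r₁ r₂ y₁ y₂ : ℂ}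
    (hr₁ : r₁ ^ 2 - y₁ * r₁ + 1 = 0) (hr₂ : r₂ ^ 2 - y₂ * r₂ + 1 = 0)
    (h : ∀ k, (y₁ * y₂ + 2) * a k - (y₁ + y₂) * (a (k - 1) + a (k + 1))
      + (a (k - 2) + a (k + 2)) = 0) : a = 0 := by
  have hb : (fun k => a (k + 2) - y₁ * a (k + 1) + a k) = 0 := by
    refine eq_zero_of_quadratic (r := r₂) (y := y₂) ?_ hr₂ fun k => ?_
    · simpa using ((tendsto_comp_add ha 2).sub ((tendsto_comp_add ha 1).const_mul y₁)).add ha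
    · have := h (k + 2)
      rw [show k + 2 - 1 = k + 1 by ring, show k + 2 + 1 = k + 3 by ring, add_sub_cancel_right,
        show k + 2 + 2 = k + 4 by ring] at this
      rw [show k + 2 + 2 = k + 4 by ring, show k + 2 + 1 = k + 3 by ring,
        show k + 1 + 2 = k + 3 by ring, show k + 1 + 1 = k + 2 by ring]
      linear_combination this
  exact eq_zero_of_quadratic ha hr₁ fun k => congrFun hb k

/-! ### The roots -/

theorem csqrt_sq (z : ℂ) : csqrt z ^ 2 = z := by
  rw [csqrt, one_div]
  exact Complex.cpow_ofNat_inv_pow z 2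

theorem csqrt_re_nonneg (z : ℂ) : 0 ≤ (csqrt z).re := by
  rw [csqrt, one_div, Complex.cpow_inv_two_re]
  exact Real.sqrt_nonneg _

/-- The numbers $(Y\pm S)/4$ have product 1, so it suffices that $|Y+S|<|Y-S|$, that is
$\mathrm{Re}(\bar YS)<0$; the signs of the real parts give this. The last hypothesis excludes
$Y\in[-4,0)$, where both numbers lie on the unit circle. -/
theorem norm_add_div_four_lt_one {Y S : ℂ} (hY : Y.re < 0) (hS : 0 ≤ S.re)
    (h : S ^ 2 = Y ^ 2 - 16) (hY' : Y.im ≠ 0 ∨ Y.re < -4) : ‖1 / 4 * Y + 1 / 4 * S‖ < 1 := by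
  have hre := congrArg Complex.re h
  have him := congrArg Complex.im h
  simp only [pow_two, Complex.mul_re, Complex.mul_im, Complex.sub_re, Complex.sub_im,
    Complex.re_ofNat, Complex.im_ofNat] at hre him
  have hneg : Y.re * S.re + Y.im * S.im < 0 := by
    rcases hS.eq_or_lt with h0 | hpos
    · exfalso
      rw [← h0] at hre him
      have : Y.re * Y.im = 0 := by linarith
      rcases mul_eq_zero.1 this with h1 | h1
      · exact hY.ne h1
      · rcases hY' with h2 | h2
        · exact h2 h1
        · rw [h1] at hre
          nlinarith [sq_nonneg S.im]
    · have h1 : S.re * (Y.re * S.re + Y.im * S.im) = Y.re * (S.re ^ 2 + Y.im ^ 2) := by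
        linear_combination Y.im / 2 * him
      have h2 : Y.re * (S.re ^ 2 + Y.im ^ 2) < 0 := mul_neg_of_neg_of_pos hY (by positivity)
      by_contra! h3
      have := mul_nonneg hpos.le h3
      linarith
  have hprod : (Y.re + S.re) ^ 2 + (Y.im + S.im) ^ 2 < 16 := by
    have e1 : ((Y.re + S.re) ^ 2 + (Y.im + S.im) ^ 2) * ((Y.re - S.re) ^ 2 + (Y.im - S.im) ^ 2)
        = 256 := by
      have h1 : Y.re * Y.re - Y.im * Y.im - (S.re * S.re - S.im * S.im) = 16 := by linarith
      have h2 : Y.re * Y.im - S.re * S.im = 0 := by linarith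
      have : ((Y.re + S.re) ^ 2 + (Y.im + S.im) ^ 2) * ((Y.re - S.re) ^ 2 + (Y.im - S.im) ^ 2)
        = (Y.re * Y.re - Y.im * Y.im - (S.re * S.re - S.im * S.im)) ^ 2
          + 4 * (Y.re * Y.im - S.re * S.im) ^ 2 := by ring
      rw [this, h1, h2]
      norm_num
    by_contra! h3
    nlinarith [mul_le_mul h3 (by nlinarith : (16 : ℝ) ≤ (Y.re + S.re) ^ 2 + (Y.im + S.im) ^ 2)
      (by norm_num) (by positivity)]
  have hn : ‖1 / 4 * Y + 1 / 4 * S‖ ^ 2 < 1 := by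
    rw [← mul_add, norm_mul, mul_pow, ← Complex.normSq_eq_norm_sq (Y + S), Complex.normSq_apply,
      Complex.add_re, Complex.add_im]
    norm_num
    nlinarith
  exact (sq_lt_one_iff₀ (norm_nonneg _)).1 hn

theorem root_relation {Y S : ℂ} (h : S ^ 2 = Y ^ 2 - 16) :
    (1 / 4 * Y + 1 / 4 * S) ^ 2 - Y / 2 * (1 / 4 * Y + 1 / 4 * S) + 1 = 0 := by
  linear_combination h / 16

/-- The square root of the discriminant. -/
def sqrtDisc (c d : ℝ) : ℂ := csqrt (d ^ 2 - 4 * d - 4 * c)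

theorem sqrtDisc_sq (c d : ℝ) : sqrtDisc c d ^ 2 = d ^ 2 - 4 * d - 4 * c := csqrt_sq _

/-- The discriminant is real. If it is negative the root is imaginary; otherwise $d(d-4)\ge4c>0$
forces $d>4$, and $d^2-4d-4c<(d-2)^2$ bounds the root. This puts $-d-2$ plus the root below $-4$. -/
theorem sqrtDisc_cases {c d : ℝ} (hc : 0 < c) (hd : 0 ≤ d) :
    ((sqrtDisc c d).im ≠ 0 ∧ (sqrtDisc c d).re = 0) ∨
      ((sqrtDisc c d).im = 0 ∧ 4 < d ∧ (sqrtDisc c d).re < d - 2) := by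
  have h := sqrtDisc_sq c d
  have hre := congrArg Complex.re h
  have him := congrArg Complex.im h
  have hp : 0 ≤ (sqrtDisc c d).re := csqrt_re_nonneg _
  simp only [pow_two, Complex.mul_re, Complex.mul_im, Complex.sub_re, Complex.sub_im,
    Complex.re_ofNat, Complex.im_ofNat, Complex.ofReal_re, Complex.ofReal_im] at hre him
  by_cases hi : (sqrtDisc c d).im = 0
  · right
    rw [hi] at hre
    have h4 : 4 < d := by
      by_contra! h4
      nlinarith [mul_self_nonneg (sqrtDisc c d).re, mul_nonneg hd (sub_nonneg.2 h4)]
    refine ⟨hi, h4, ?_⟩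
    by_contra! h5
    nlinarith [mul_self_le_mul_self (by linarith : 0 ≤ d - 2) h5]
  · left
    refine ⟨hi, ?_⟩
    have : (sqrtDisc c d).re * (sqrtDisc c d).im = 0 := by linarith
    exact (mul_eq_zero.1 this).resolve_right hi

/-- The value of `x₁ + x₁⁻¹`. -/
def sum₁ (c d : ℝ) : ℂ := (-d - 2 + sqrtDisc c d) / 2

/-- The value of `x₂ + x₂⁻¹`. -/
def sum₂ (c d : ℝ) : ℂ := (-d - 2 - sqrtDisc c d) / 2

theorem sum₁_add_sum₂ (c d : ℝ) : sum₁ c d + sum₂ c d = -(d + 2) := by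
  rw [sum₁, sum₂]
  ring

theorem sum₁_mul_sum₂ (c d : ℝ) : sum₁ c d * sum₂ c d + 2 = c + 2 * d + 3 := by
  rw [sum₁, sum₂]
  linear_combination -sqrtDisc_sq c d / 4

theorem root₁_relation (c d : ℝ) : root₁ c d ^ 2 - sum₁ c d * root₁ c d + 1 = 0 :=
  root_relation (csqrt_sq _)

theorem root₂_relation (c d : ℝ) : root₂ c d ^ 2 - sum₂ c d * root₂ c d + 1 = 0 :=
  root_relation (csqrt_sq _)

theorem norm_root₁_lt_one {c d : ℝ} (hc : 0 < c) (hd : 0 ≤ d) : ‖root₁ c d‖ < 1 := by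
  have h := sqrtDisc_cases hc hd
  refine norm_add_div_four_lt_one ?_ (csqrt_re_nonneg _) (csqrt_sq _) ?_ <;>
    rw [← sqrtDisc] <;>
    simp only [Complex.add_re, Complex.sub_re, Complex.neg_re, Complex.ofReal_re, Complex.re_ofNat,
      Complex.add_im, Complex.sub_im, Complex.neg_im, Complex.ofReal_im, Complex.im_ofNat]
  · rcases h with ⟨h1, h2⟩ | ⟨h1, h2, h3⟩ <;> linarith
  · rcases h with ⟨h1, h2⟩ | ⟨h1, h2, h3⟩
    · left; simpa using h1
    · right; linarith

theorem norm_root₂_lt_one {c d : ℝ} (hc : 0 < c) (hd : 0 ≤ d) : ‖root₂ c d‖ < 1 := by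
  have h := sqrtDisc_cases hc hd
  have hp : 0 ≤ (sqrtDisc c d).re := csqrt_re_nonneg _
  refine norm_add_div_four_lt_one ?_ (csqrt_re_nonneg _) (csqrt_sq _) ?_ <;>
    rw [← sqrtDisc] <;>
    simp only [Complex.sub_re, Complex.neg_re, Complex.ofReal_re, Complex.re_ofNat,
      Complex.sub_im, Complex.neg_im, Complex.ofReal_im, Complex.im_ofNat]
  · linarith
  · rcases h with ⟨h1, h2⟩ | ⟨h1, h2, h3⟩
    · left; simpa using h1
    · right; linarith

theorem ne_zero_of_relation {x y : ℂ} (h : x ^ 2 - y * x + 1 = 0) : x ≠ 0 := by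
  rintro rfl
  norm_num at h

theorem sum_eq_of_relation {x y : ℂ} (h : x ^ 2 - y * x + 1 = 0) : y = x + x⁻¹ := by
  have hx := ne_zero_of_relation h
  field_simp
  linear_combination -h

open Polynomial in
theorem quartic_eq (c d : ℝ) : quartic c d = C ((c : ℂ)⁻¹) *
    ((X ^ 2 - C (sum₁ c d) * X + 1) * (X ^ 2 - C (sum₂ c d) * X + 1)) := by
  have h1 := congrArg (C : ℂ → ℂ[X]) (sum₁_add_sum₂ c d)
  have h2 := congrArg (C : ℂ → ℂ[X]) (sum₁_mul_sum₂ c d)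
  rw [quartic]
  simp only [map_add, map_mul, map_neg] at h1 h2 ⊢
  have h3 : (C 2 : ℂ[X]) = 2 := rfl
  rw [h3] at h2 ⊢
  rw [h3] at h1
  linear_combination C ((c : ℂ)⁻¹) * ((X ^ 3 + X) * h1 - X ^ 2 * h2)

open Polynomial in
theorem quadratic_eq {x y : ℂ} (h : x ^ 2 - y * x + 1 = 0) :
    (X ^ 2 - C y * X + 1 : ℂ[X]) = (X - C x) * (X - C x⁻¹) := by
  have hx := ne_zero_of_relation h
  have h1 : (C x * C x⁻¹ : ℂ[X]) = 1 := by rw [← C_mul, mul_inv_cancel₀ hx, C_1]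
  rw [sum_eq_of_relation h, C_add]
  linear_combination -h1

open Polynomial in
-- The four roots are $x_1,x_2$ and their inverses, and the inverses lie outside the closed disk.
theorem roots_quartic_filter {c d : ℝ} (hc : 0 < c) (hd : 0 ≤ d)
    [DecidablePred fun z : ℂ => ‖z‖ < 1] :
    (quartic c d).roots.filter (fun z => ‖z‖ < 1) = {root₁ c d, root₂ c d} := by
  have hc' : (c : ℂ)⁻¹ ≠ 0 := inv_ne_zero (Complex.ofReal_ne_zero.2 hc.ne')
  have hroots : (quartic c d).roots
      = {root₁ c d, (root₁ c d)⁻¹, root₂ c d, (root₂ c d)⁻¹} := by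
    rw [quartic_eq, roots_C_mul _ hc', quadratic_eq (root₁_relation c d),
      quadratic_eq (root₂_relation c d)]
    have : (X - C (root₁ c d)) * (X - C (root₁ c d)⁻¹) *
        ((X - C (root₂ c d)) * (X - C (root₂ c d)⁻¹))
        = (Multiset.map (fun a => X - C a)
          {root₁ c d, (root₁ c d)⁻¹, root₂ c d, (root₂ c d)⁻¹}).prod := by
      simp [mul_assoc]
    rw [this, roots_multiset_prod_X_sub_C]
  have h1 := norm_root₁_lt_one hc hd
  have h2 := norm_root₂_lt_one hc hd
  have hinv : ∀ x : ℂ, x ≠ 0 → ‖x‖ < 1 → ¬ ‖x⁻¹‖ < 1 := by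
    intro x hx h
    rw [norm_inv, not_lt]
    exact (one_le_inv₀ (norm_pos_iff.2 hx)).2 h.le
  have h3 := hinv _ (ne_zero_of_relation (root₁_relation c d)) h1
  have h4 := hinv _ (ne_zero_of_relation (root₂_relation c d)) h2
  rw [hroots]
  simp only [Multiset.insert_eq_cons]
  simp only [Multiset.filter_cons, Multiset.filter_singleton, if_pos h1, if_neg h3, if_pos h2,
    if_neg h4, Multiset.empty_eq_zero, zero_add, add_zero, Multiset.singleton_add]

theorem sum₁_ne_sum₂ {c d : ℝ} (h : d ^ 2 - 4 * d - 4 * c ≠ 0) : sum₁ c d ≠ sum₂ c d := by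
  intro heq
  have h0 : sqrtDisc c d = 0 := by
    rw [sum₁, sum₂] at heq
    linear_combination heq
  have h1 := sqrtDisc_sq c d
  rw [h0] at h1
  refine h ?_
  rw [← Complex.ofReal_inj]
  push_cast
  linear_combination -h1

theorem root₁_ne_root₂ {c d : ℝ} (h : d ^ 2 - 4 * d - 4 * c ≠ 0) : root₁ c d ≠ root₂ c d := by
  intro heq
  refine sum₁_ne_sum₂ h ?_
  rw [sum_eq_of_relation (root₁_relation c d), sum_eq_of_relation (root₂_relation c d), heq]

theorem sub_inv_ne_zero {x : ℂ} (hx : x ≠ 0) (h : ‖x‖ < 1) : x - x⁻¹ ≠ 0 := by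
  intro h0
  have h1 : x * x = 1 := by
    have := congrArg (x * ·) h0
    simp only [mul_sub, mul_inv_cancel₀ hx, mul_zero] at this
    linear_combination this
  have h2 := congrArg norm h1
  rw [norm_mul, norm_one] at h2
  nlinarith [norm_nonneg x]

/-! ### The explicit formula for the Fourier coefficients -/

open Polynomial in
-- Only the derivative of the factor vanishing at `x` survives. There $2x-y=x-x^{-1}$, and
-- $x^2+1=yx$ turns the other factor into $x(y-y')$.
theorem div_derivative_eval {x y : ℂ} (h : x ^ 2 - y * x + 1 = 0) (a y' : ℂ) :
    x / (C a⁻¹ * ((X ^ 2 - C y * X + 1) * (X ^ 2 - C y' * X + 1))).derivative.eval x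
      = a / ((x - x⁻¹) * (y - y')) := by
  have hx := ne_zero_of_relation h
  have h' : (C a⁻¹ * ((X ^ 2 - C y * X + 1) * (X ^ 2 - C y' * X + 1))).derivative.eval x
      = a⁻¹ * ((x - x⁻¹) * (y - y')) * x := by
    simp only [derivative_mul, derivative_add, derivative_sub, derivative_C, derivative_X_pow,
      derivative_X, derivative_one, eval_mul, eval_add, eval_sub, eval_C, eval_pow, eval_X,
      eval_one, eval_zero]
    obtain rfl := sum_eq_of_relation h
    field_simp
    push_cast
    ring
  rw [h', div_mul_cancel_right₀ hx, mul_inv, inv_inv, div_eq_mul_inv]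

theorem root₁_div_derivative (c d : ℝ) :
    root₁ c d / (quartic c d).derivative.eval (root₁ c d)
      = c / ((root₁ c d - (root₁ c d)⁻¹) * (sum₁ c d - sum₂ c d)) := by
  rw [quartic_eq, div_derivative_eval (root₁_relation c d)]

theorem root₂_div_derivative (c d : ℝ) :
    root₂ c d / (quartic c d).derivative.eval (root₂ c d)
      = c / ((root₂ c d - (root₂ c d)⁻¹) * (sum₂ c d - sum₁ c d)) := by
  rw [quartic_eq, mul_comm (_ - _ + _) (_ - _ + _), div_derivative_eval (root₂_relation c d)]

theorem tendsto_pow_natAbs {x : ℂ} (hx : ‖x‖ < 1) :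
    Tendsto (fun k : ℤ => x ^ k.natAbs) cofinite (𝓝 0) := by
  refine (tendsto_pow_atTop_nhds_zero_of_norm_lt_one hx).comp ?_
  rw [← Nat.cofinite_eq_atTop]
  refine Tendsto.cofinite_of_finite_preimage_singleton fun n => ?_
  refine (Set.toFinite {(n : ℤ), -(n : ℤ)}).subset fun k hk => ?_
  simp only [Set.mem_preimage, Set.mem_singleton_iff] at hk
  simp only [Set.mem_insert_iff, Set.mem_singleton_iff]
  lia

/-- The symmetric second-order recurrence for `x ^ |k|`. -/
theorem pow_natAbs_recurrence {x y : ℂ} (h : x ^ 2 - y * x + 1 = 0) (k : ℤ) :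
    x ^ (k - 1).natAbs + x ^ (k + 1).natAbs
      = y * x ^ k.natAbs + (x - x⁻¹) * if k = 0 then 1 else 0 := by
  have hy := sum_eq_of_relation h
  have hx := ne_zero_of_relation h
  rcases lt_trichotomy k 0 with hk | rfl | hk
  · obtain ⟨n, rfl⟩ : ∃ n : ℕ, k = -(n + 1) := ⟨(-k - 1).toNat, by lia⟩
    rw [if_neg (by lia), show (-((n : ℤ) + 1) - 1).natAbs = n + 2 by lia,
      show (-((n : ℤ) + 1) + 1).natAbs = n by lia, show (-((n : ℤ) + 1)).natAbs = n + 1 by lia]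
    linear_combination x ^ n * h
  · simp only [zero_sub, Int.natAbs_neg, zero_add, Int.natAbs_one, Int.natAbs_zero, if_true, hy]
    ring
  · obtain ⟨n, rfl⟩ : ∃ n : ℕ, k = n + 1 := ⟨(k - 1).toNat, by lia⟩
    rw [if_neg (by lia), show ((n : ℤ) + 1 - 1).natAbs = n by lia,
      show ((n : ℤ) + 1 + 1).natAbs = n + 2 by lia, show ((n : ℤ) + 1).natAbs = n + 1 by lia]
    linear_combination x ^ n * h

theorem fourierHat_symbol_eq {c d : ℝ} (hc : 0 < c) (hd : 0 ≤ d)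
    (h : d ^ 2 - 4 * d - 4 * c ≠ 0) (m : ℤ) :
    fourierHat (symbol c d) m
      = root₁ c d / (quartic c d).derivative.eval (root₁ c d) * root₁ c d ^ m.natAbs
        + root₂ c d / (quartic c d).derivative.eval (root₂ c d) * root₂ c d ^ m.natAbs := by
  rw [root₁_div_derivative, root₂_div_derivative]
  have e1 := root₁_relation c d
  have e2 := root₂_relation c d
  have n1 := norm_root₁_lt_one hc hd
  have n2 := norm_root₂_lt_one hc hd
  have s1 := sub_inv_ne_zero (ne_zero_of_relation e1) n1
  have s2 := sub_inv_ne_zero (ne_zero_of_relation e2) n2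
  have hne := sub_ne_zero.2 (sum₁_ne_sum₂ h)
  have hadd := sum₁_add_sum₂ c d
  have hmul := sum₁_mul_sum₂ c d
  generalize root₁ c d = x₁ at *
  generalize root₂ c d = x₂ at *
  generalize sum₁ c d = y₁ at *
  generalize sum₂ c d = y₂ at *
  set A₁ : ℂ := c / ((x₁ - x₁⁻¹) * (y₁ - y₂)) with hA₁
  set A₂ : ℂ := c / ((x₂ - x₂⁻¹) * (y₂ - y₁)) with hA₂
  -- The sources that the two geometric terms create at the origin have opposite strengths $\pm
  -- c/(y_1-y_2)$.
  have hA : A₁ * (x₁ - x₁⁻¹) = c / (y₁ - y₂) := by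
    rw [hA₁]
    generalize x₁ - x₁⁻¹ = s at *
    field_simp
  have hA' : A₂ * (x₂ - x₂⁻¹) = -(c / (y₁ - y₂)) := by
    have hne' : y₂ - y₁ ≠ 0 := by rwa [← neg_sub, neg_ne_zero]
    rw [hA₂, ← neg_sub y₂ y₁, div_neg, neg_neg]
    generalize x₂ - x₂⁻¹ = s at *
    generalize y₂ - y₁ = t at *
    field_simp
  have hdiff : c / (y₁ - y₂) * (y₁ - y₂) = c := div_mul_cancel₀ _ hne
  generalize (c : ℂ) / (y₁ - y₂) = q at *
  have key : (fun k : ℤ => fourierHat (symbol c d) k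
      - (A₁ * x₁ ^ k.natAbs + A₂ * x₂ ^ k.natAbs)) = 0 := by
    refine eq_zero_of_quartic ?_ e1 e2 fun k => ?_
    · simpa using (tendsto_fourierHat_cofinite (symbol c d)).sub
        (((tendsto_pow_natAbs n1).const_mul A₁).add ((tendsto_pow_natAbs n2).const_mul A₂))
    · have hf := fourierHat_symbol_recurrence hc hd k
      rw [← hmul, show (d : ℂ) + 2 = -(y₁ + y₂) by rw [hadd, neg_neg]] at hf
      have p0 := pow_natAbs_recurrence e1 k
      have p1 := pow_natAbs_recurrence e1 (k - 1)
      have p2 := pow_natAbs_recurrence e1 (k + 1)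
      have q0 := pow_natAbs_recurrence e2 k
      have q1 := pow_natAbs_recurrence e2 (k - 1)
      have q2 := pow_natAbs_recurrence e2 (k + 1)
      simp only [sub_add_cancel, add_sub_cancel_right, show k - 1 - 1 = k - 2 by ring,
        show k + 1 + 1 = k + 2 by ring] at p1 p2 q1 q2
      rw [show (if k = 0 then (c : ℂ) else 0) = c * if k = 0 then 1 else 0 by simp] at hf
      generalize (if k = 0 then (1 : ℂ) else 0) = δ₀ at *
      generalize (if k - 1 = 0 then (1 : ℂ) else 0) = δ₁ at *
      generalize (if k + 1 = 0 then (1 : ℂ) else 0) = δ₂ at *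
      -- Each quadratic operator reduces its own term to a point source, to which the other one is
      -- then applied. The sources at $k=\pm1$ cancel, and $c(y_1-y_2)/(y_1-y_2)=c$ remains at
      -- $k=0$, as for $\hat f$.
      linear_combination hf - A₁ * (p1 + p2 - y₂ * p0) - A₂ * (q1 + q2 - y₁ * q0)
        - (δ₁ + δ₂ - y₂ * δ₀) * hA - (δ₁ + δ₂ - y₁ * δ₀) * hA' - δ₀ * hdiff
  exact sub_eq_zero.1 (congrFun key m)

end EnhancedHelix

end

open Classical in
theorem theorem4 (c d : ℝ) (hc : 0 < c) (hd : 0 ≤ d) :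
    -- the weighted random spanning tree on the infinite graph is well defined
    (∃! P : Measure (Set (Sym2 ℤ)), EnhancedHelix.IsSpanningTreeMeasure c d P) ∧
    -- the rung process is determinantal, with a real symmetric Toeplitz matrix
    (∀ P : Measure (Set (Sym2 ℤ)), EnhancedHelix.IsSpanningTreeMeasure c d P →
      EnhancedHelix.IsDeterminantal P EnhancedHelix.rungProcess (EnhancedHelix.kernel c d)) ∧
    (∀ k l : ℤ, (EnhancedHelix.kernel c d k l).im = 0 ∧
      EnhancedHelix.kernel c d k l = EnhancedHelix.kernel c d l k) ∧
    -- the function `f` is a measurable function with values in `(0, 1]`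
    Measurable (EnhancedHelix.symbol c d) ∧
    (∀ x : ℝ, 0 < EnhancedHelix.symbol c d x ∧ EnhancedHelix.symbol c d x ≤ 1) ∧
    -- with multiplicity, `x₁, x₂` are the roots of `g` in the open unit disk
    (EnhancedHelix.quartic c d).roots.filter (fun z => ‖z‖ < 1)
      = {EnhancedHelix.root₁ c d, EnhancedHelix.root₂ c d} ∧
    -- they are distinct unless `d ^ 2 - 4 * d - 4 * c = 0`, and then `f̂` has the explicit form
    (d ^ 2 - 4 * d - 4 * c ≠ 0 →
      EnhancedHelix.root₁ c d ≠ EnhancedHelix.root₂ c d ∧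
      ∀ m : ℤ, EnhancedHelix.fourierHat (EnhancedHelix.symbol c d) m
        = EnhancedHelix.root₁ c d
            / (EnhancedHelix.quartic c d).derivative.eval (EnhancedHelix.root₁ c d)
            * EnhancedHelix.root₁ c d ^ m.natAbs
          + EnhancedHelix.root₂ c d
            / (EnhancedHelix.quartic c d).derivative.eval (EnhancedHelix.root₂ c d)
            * EnhancedHelix.root₂ c d ^ m.natAbs) := by
  refine ⟨?_, fun P hP => EnhancedHelix.isDeterminantal_rungProcess hc hd hP, fun k l => ⟨?_, ?_⟩,
    (EnhancedHelix.continuous_symbol hc hd).measurable,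
    fun x => ⟨EnhancedHelix.symbol_pos hc hd x, EnhancedHelix.symbol_le_one hc hd x⟩,
    EnhancedHelix.roots_quartic_filter hc hd,
    fun h => ⟨EnhancedHelix.root₁_ne_root₂ h, EnhancedHelix.fourierHat_symbol_eq hc hd h⟩⟩
  · obtain ⟨P, hP⟩ := EnhancedHelix.exists_isSpanningTreeMeasure hc hd
    exact ⟨P, hP, fun Q hQ => hQ.unique hP⟩
  · exact EnhancedHelix.fourierHat_symbol_im c d _
  · exact EnhancedHelix.kernel_symm hc d k l
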